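/- Let $n\ge 1$, $0<\beta<1$, $0<\alpha<n$ and $\alpha+\beta<n$, and let $b$ be a real-valued locally integrable function on $\mathbb{R}^n$. Functions are identified when they agree almost everywhere. Notation. A cube is a cube in $\mathbb{R}^n$ with sides parallel to the coordinate axes, $|Q|$ is its Lebesgue measure and $\chi_Q$ its characteristic function. For $0\le\gamma<n$ put $$M_\gamma f(x)=\sup_{Q\ni x}\frac{1}{|Q|^{1-\gamma/n}}\int_Q|f(y)|\,dy,\qquad M=M_0,\qquad [b,M_\alpha]f=b\,M_\alpha f-M_\alpha(bf),$$ and for a cube $Q_0$ let $M_{\gamma,Q_0}f(x)$ be the same supremum restricted to the cubes $Q$ with $x\in Q\subseteq Q_0$. For a measurable $p(\cdot):\mathbb{R}^n\to[1,\infty)$ let $L^{p(\cdot)}$ be the space of measurable $f$ with $\int_{\mathbb{R}^n}(|f(x)|/\lambda)^{p(x)}\,dx<\infty$ for some $\lambda>0$, with the norm $\|f\|_{p(\cdot)}=\inf\{\lambda>0:\int_{\mathbb{R}^n}(|f(x)|/\lambda)^{p(x)}\,dx\le1\}$. Let $p_-$ and $p_+$ be the essential infimum and supremum of $p(\cdot)$.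 Let $\mathscr{P}$ be the set of measurable $p(\cdot):\mathbb{R}^n\to[1,\infty)$ with $1<p_-$ and $p_+<\infty$, and let $\mathscr{B}$ be the set of $p(\cdot)\in\mathscr{P}$ such that $M$ is bounded on $L^{p(\cdot)}$. For $0<\gamma<n$ let $\mathscr{B}^\gamma$ be the set of pairs $(p(\cdot),q(\cdot))$ with $p(\cdot)\in\mathscr{P}$, $p_+<n/\gamma$, $1/q(\cdot)=1/p(\cdot)-\gamma/n$ and $q(\cdot)(n-\gamma)/n\in\mathscr{B}$. The operator $[b,M_\alpha]$ is bounded from $L^{p(\cdot)}$ to $L^{q(\cdot)}$ if there is a constant $C<\infty$ with $\|[b,M_\alpha]f\|_{q(\cdot)}\le C\|f\|_{p(\cdot)}$ for all $f\in L^{p(\cdot)}$. Let $\dot\Lambda_\beta$ be the set of functions $g$ on $\mathbb{R}^n$ for which there is a constant $C>0$ with $|g(x)-g(y)|\le C|x-y|^\beta$ for all $x,y\in\mathbb{R}^n$. Theorem. The following statements are equivalent: (1) $b\in\dot\Lambda_\beta$ and $b\ge0$, that is, $b$ agrees almost everywhere with a non-negative function in $\dot\Lambda_\beta$. (2) $[b,M_\alpha]$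 is bounded from $L^{p(\cdot)}$ to $L^{q(\cdot)}$ for some $(p(\cdot),q(\cdot))\in\mathscr{B}^{\alpha+\beta}$. (3) $[b,M_\alpha]$ is bounded from $L^{p(\cdot)}$ to $L^{q(\cdot)}$ for all $(p(\cdot),q(\cdot))\in\mathscr{B}^{\alpha+\beta}$. (4) There exists $s(\cdot)\in\mathscr{B}$ such that $$\sup_Q\frac{1}{|Q|^{\beta/n}}\,\frac{\big\|\big(b-|Q|^{-\alpha/n}M_{\alpha,Q}(b)\big)\chi_Q\big\|_{s(\cdot)}}{\|\chi_Q\|_{s(\cdot)}}<\infty,$$ where the supremum is taken over all cubes $Q$. (5) The condition in (4) holds for all $s(\cdot)\in\mathscr{B}$. -/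

import Mathlib

open MeasureTheory
open scoped ENNReal NNReal

noncomputable section

namespace VarLip

/-- The Euclidean space `ℝⁿ`, with the Euclidean norm and Lebesgue measure. -/
abbrev Rn (n : ℕ) : Type := EuclideanSpace ℝ (Fin n)

/-- Cubes with sides parallel to the coordinate axes (closed, of side length `r > 0`). -/
def IsCube {n : ℕ} (Q : Set (Rn n)) : Prop :=
  ∃ (a : Rn n) (r : ℝ), 0 < r ∧ Q = {y | ∀ i, y i ∈ Set.Icc (a i) (a i + r)}

/-- The fractional maximal function
`M_γ f (x) = sup_{Q ∋ x} |Q|^{-(1 - γ/n)} ∫_Q |f|`, with values in `[0, ∞]`. -/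
def fracMax {n : ℕ} (γ : ℝ) (f : Rn n → ℝ) (x : Rn n) : ℝ≥0∞ :=
  ⨆ (Q : Set (Rn n)) (_ : IsCube Q) (_ : x ∈ Q),
    (∫⁻ y in Q, ‖f y‖ₑ) / volume Q ^ (1 - γ / (n : ℝ))

/-- The fractional maximal function relative to a cube `Q₀`: the supremum is restricted to the
cubes `Q` with `x ∈ Q ⊆ Q₀`. -/
def fracMaxOn {n : ℕ} (γ : ℝ) (Q₀ : Set (Rn n)) (f : Rn n → ℝ) (x : Rn n) : ℝ≥0∞ :=
  ⨆ (Q : Set (Rn n)) (_ : IsCube Q) (_ : x ∈ Q) (_ : Q ⊆ Q₀),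
    (∫⁻ y in Q, ‖f y‖ₑ) / volume Q ^ (1 - γ / (n : ℝ))

/-- The nonlinear commutator `[b, M_γ] f = b M_γ f - M_γ (b f)`, with extended real values.
The form `∞ - ∞` is `⊥`, so that its modulus is `∞`. -/
def commutator {n : ℕ} (γ : ℝ) (b f : Rn n → ℝ) (x : Rn n) : EReal :=
  (b x : EReal) * (fracMax γ f x : EReal) - (fracMax γ (fun y => b y * f y) x : EReal)

/-- The homogeneous Lipschitz condition of order `β`. -/
def IsHomLipschitz {n : ℕ} (β : ℝ) (b : Rn n → ℝ) : Prop :=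
  ∃ C : ℝ, 0 < C ∧ ∀ x y : Rn n, |b x - b y| ≤ C * ‖x - y‖ ^ β

/-- The modular `∫ (g(x)/t)^{p(x)} dx`, where `g : ℝⁿ → [0, ∞]` is the modulus of a function. -/
def modular {n : ℕ} (p : Rn n → ℝ) (g : Rn n → ℝ≥0∞) (t : ℝ≥0) : ℝ≥0∞ :=
  ∫⁻ x, (g x / (t : ℝ≥0∞)) ^ p x

/-- The variable Lebesgue (Luxemburg) norm of a function with modulus `g : ℝⁿ → [0, ∞]`;
it is `∞` if no `t > 0` is admissible. -/
def varNorm {n : ℕ} (p : Rn n → ℝ) (g : Rn n → ℝ≥0∞) : ℝ≥0∞ :=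
  ⨅ (t : ℝ≥0) (_ : 0 < t) (_ : modular p g t ≤ 1), (t : ℝ≥0∞)

/-- Membership of a real function in the variable Lebesgue space `L^{p(·)}(ℝⁿ)`. -/
def MemVarLp {n : ℕ} (p : Rn n → ℝ) (f : Rn n → ℝ) : Prop :=
  AEMeasurable f volume ∧ ∃ t : ℝ≥0, 0 < t ∧ modular p (fun x => ‖f x‖ₑ) t < ∞

/-- The class `𝒫(ℝⁿ)`: measurable `p : ℝⁿ → [1, ∞)` with `1 < p₋` and `p₊ < ∞`. The essential
bounds are taken in the extended reals. -/
def ExpP {n : ℕ} (p : Rn n → ℝ) : Prop :=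
  Measurable p ∧ (∀ x, 1 ≤ p x) ∧
    (1 : EReal) < essInf (fun x => (p x : EReal)) volume ∧
    essSup (fun x => (p x : EReal)) volume < ⊤

/-- The class `ℬ(ℝⁿ)`: those `p ∈ 𝒫(ℝⁿ)` for which the Hardy-Littlewood maximal operator
`M = M_0` is bounded on `L^{p(·)}(ℝⁿ)`. -/
def ExpB {n : ℕ} (p : Rn n → ℝ) : Prop :=
  ExpP p ∧ ∃ C : ℝ≥0, ∀ f : Rn n → ℝ, MemVarLp p f →
    varNorm p (fracMax 0 f) ≤ C * varNorm p (fun x => ‖f x‖ₑ)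

/-- The class `ℬ^γ(ℝⁿ)` of pairs of exponents. -/
def ExpPair {n : ℕ} (γ : ℝ) (p q : Rn n → ℝ) : Prop :=
  ExpP p ∧ essSup (fun x => (p x : EReal)) volume < (((n : ℝ) / γ : ℝ) : EReal) ∧
    (∀ x, 1 / q x = 1 / p x - γ / (n : ℝ)) ∧
    ExpB (fun x => q x * ((n : ℝ) - γ) / (n : ℝ))

/-- `[b, M_γ]` is bounded from `L^{p(·)}(ℝⁿ)` to `L^{q(·)}(ℝⁿ)`. A finite norm forces
`[b, M_γ] f` to be finite almost everywhere. -/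
def CommutatorBounded {n : ℕ} (γ : ℝ) (b : Rn n → ℝ) (p q : Rn n → ℝ) : Prop :=
  ∃ C : ℝ≥0, ∀ f : Rn n → ℝ, MemVarLp p f →
    varNorm q (fun x => (commutator γ b f x).abs) ≤ C * varNorm p (fun x => ‖f x‖ₑ)

/-- The condition `sup_Q |Q|^{-β/n} ‖(b - |Q|^{-α/n} M_{α,Q} b) χ_Q‖_{s(·)} / ‖χ_Q‖_{s(·)} < ∞`. -/
def OscillationFinite {n : ℕ} (α β : ℝ) (b : Rn n → ℝ) (s : Rn n → ℝ) : Prop :=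
  (⨆ (Q : Set (Rn n)) (_ : IsCube Q),
    1 / volume Q ^ (β / (n : ℝ)) *
      (varNorm s (Q.indicator fun x =>
          ((b x : EReal) -
            ((volume Q ^ (-(α / (n : ℝ))) * fracMaxOn α Q b x : ℝ≥0∞) : EReal)).abs) /
        varNorm s (Q.indicator fun _ => 1))) < ∞

end VarLip

end

open MeasureTheory
open scoped ENNReal NNReal

noncomputable section

namespace VarLip

/-! ### Cubes -/

/-- The closed cube with lower corner `a` and side length `r`. -/
def cube {n : ℕ} (a : Rn n) (r : ℝ) : Set (Rn n) :=
  {y | ∀ i, y i ∈ Set.Icc (a i) (a i + r)}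

theorem isCube_cube {n : ℕ} (a : Rn n) {r : ℝ} (hr : 0 < r) : IsCube (cube a r) :=
  ⟨a, r, hr, rfl⟩

theorem cube_eq_preimage {n : ℕ} (a : Rn n) (r : ℝ) :
    cube a r = (WithLp.ofLp : Rn n → Fin n → ℝ) ⁻¹'
      Set.Icc (WithLp.ofLp a) (fun i => a i + r) := by
  ext y
  simp only [cube, Set.mem_ofPred_eq, Set.mem_Icc, Set.mem_preimage, Pi.le_def]
  exact forall_and

theorem measurableSet_cube {n : ℕ} (a : Rn n) (r : ℝ) : MeasurableSet (cube a r) := by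
  rw [cube_eq_preimage]
  exact (PiLp.volume_preserving_ofLp (Fin n)).measurable measurableSet_Icc

theorem volume_cube {n : ℕ} (a : Rn n) {r : ℝ} (hr : 0 ≤ r) :
    volume (cube a r) = ENNReal.ofReal (r ^ n) := by
  rw [cube_eq_preimage, (PiLp.volume_preserving_ofLp (Fin n)).measure_preimage
    measurableSet_Icc.nullMeasurableSet, Real.volume_Icc_pi]
  simp [ENNReal.ofReal_pow hr]

theorem volume_cube_rpow {n : ℕ} (hn : n ≠ 0) (a : Rn n) {r : ℝ} (hr : 0 < r) (θ : ℝ) :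
    volume (cube a r) ^ (θ / n) = ENNReal.ofReal (r ^ θ) := by
  have hn' : (n : ℝ) ≠ 0 := Nat.cast_ne_zero.2 hn
  rw [volume_cube a hr.le, ENNReal.ofReal_rpow_of_pos (by positivity), ← Real.rpow_natCast,
    ← Real.rpow_mul hr.le]
  congr 2
  field_simp

theorem IsCube.measurableSet {n : ℕ} {Q : Set (Rn n)} (hQ : IsCube Q) : MeasurableSet Q := by
  obtain ⟨a, r, -, rfl⟩ := hQ
  exact measurableSet_cube a r

theorem IsCube.volume_ne_zero {n : ℕ} {Q : Set (Rn n)} (hQ : IsCube Q) : volume Q ≠ 0 := by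
  obtain ⟨a, r, hr, rfl⟩ := hQ
  rw [← cube, volume_cube a hr.le]
  simpa using pow_pos hr n

theorem IsCube.volume_ne_top {n : ℕ} {Q : Set (Rn n)} (hQ : IsCube Q) : volume Q ≠ ⊤ := by
  obtain ⟨a, r, hr, rfl⟩ := hQ
  rw [← cube, volume_cube a hr.le]
  exact ENNReal.ofReal_ne_top

theorem norm_sub_le_of_mem_cube {n : ℕ} {a x y : Rn n} {r : ℝ} (hr : 0 ≤ r) (hx : x ∈ cube a r)
    (hy : y ∈ cube a r) : ‖x - y‖ ≤ √n * r := by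
  rw [EuclideanSpace.norm_eq]
  refine Real.sqrt_le_iff.2 ⟨by positivity, ?_⟩
  rw [mul_pow, Real.sq_sqrt (Nat.cast_nonneg n)]
  calc ∑ i, ‖(x - y) i‖ ^ 2 ≤ ∑ _i : Fin n, r ^ 2 := by
        refine Finset.sum_le_sum fun i _ => pow_le_pow_left₀ (norm_nonneg _) ?_ 2
        have h1 := hx i
        have h2 := hy i
        rw [Set.mem_Icc] at h1 h2
        rw [PiLp.sub_apply, Real.norm_eq_abs, abs_le]
        constructor <;> linarith
    _ = n * r ^ 2 := by simp

theorem cube_subset_closedBall {n : ℕ} {a x : Rn n} {r : ℝ} (hr : 0 ≤ r) (hx : x ∈ cube a r) :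
    cube a r ⊆ Metric.closedBall x (√n * r) := fun y hy => by
  rw [Metric.mem_closedBall, dist_eq_norm]
  exact norm_sub_le_of_mem_cube hr hy hx

theorem closedBall_subset_cube {n : ℕ} (x : Rn n) (R : ℝ) :
    Metric.closedBall x R ⊆ cube (WithLp.toLp 2 fun i => x i - R) (2 * R) := fun y hy i => by
  rw [Metric.mem_closedBall, dist_eq_norm] at hy
  have := (PiLp.norm_apply_le (y - x) i).trans hy
  rw [PiLp.sub_apply, Real.norm_eq_abs, abs_le] at this
  constructor <;> simp only <;> linarith

theorem IsCube.isBounded {n : ℕ} {Q : Set (Rn n)} (hQ : IsCube Q) : Bornology.IsBounded Q := by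
  obtain ⟨a, r, hr, rfl⟩ := hQ
  refine Metric.isBounded_closedBall.subset (cube_subset_closedBall (x := a) hr.le fun i => ?_)
  simp [hr.le]

theorem IsCube.lintegral_enorm_ne_top {n : ℕ} {b : Rn n → ℝ} (hb : LocallyIntegrable b volume)
    {Q : Set (Rn n)} (hQ : IsCube Q) : ∫⁻ y in Q, ‖b y‖ₑ ≠ ⊤ :=
  ((hb.integrableOn_isCompact hQ.isBounded.isCompact_closure).mono_set subset_closure).2.ne

/-! ### The Luxemburg norm -/

section varNorm

variable {n : ℕ} {p : Rn n → ℝ} {g h : Rn n → ℝ≥0∞}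

theorem varNorm_le {t : ℝ≥0} (ht : 0 < t) (hm : modular p g t ≤ 1) : varNorm p g ≤ t :=
  iInf_le_of_le t (iInf_le_of_le ht (iInf_le _ hm))

theorem exists_modular_le_of_varNorm_lt {c : ℝ≥0∞} (hc : varNorm p g < c) :
    ∃ t : ℝ≥0, 0 < t ∧ (t : ℝ≥0∞) < c ∧ modular p g t ≤ 1 := by
  simp only [varNorm, iInf_lt_iff] at hc
  obtain ⟨t, ht, hm, htc⟩ := hc
  exact ⟨t, ht, htc, hm⟩

theorem le_mul_varNorm {a : ℝ≥0∞} {C : ℝ≥0} (hC : C ≠ 0)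
    (H : ∀ t : ℝ≥0, 0 < t → modular p g t ≤ 1 → a ≤ C * t) : a ≤ C * varNorm p g := by
  have hC' : (C : ℝ≥0∞) ≠ 0 := by simpa using hC
  rw [mul_comm, ← ENNReal.div_le_iff hC' ENNReal.coe_ne_top]
  refine le_iInf fun t => le_iInf fun ht => le_iInf fun hm => ?_
  rw [ENNReal.div_le_iff hC' ENNReal.coe_ne_top, mul_comm]
  exact H t ht hm

theorem modular_mono (hp : ∀ x, 0 ≤ p x) (hgh : ∀ᵐ x, g x ≤ h x) (t : ℝ≥0) :
    modular p g t ≤ modular p h t :=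
  lintegral_mono_ae <| hgh.mono fun x hx =>
    ENNReal.rpow_le_rpow (ENNReal.div_le_div_right hx _) (hp x)

theorem modular_anti (hp : ∀ x, 0 ≤ p x) {t u : ℝ≥0} (htu : t ≤ u) :
    modular p g u ≤ modular p g t :=
  lintegral_mono fun x =>
    ENNReal.rpow_le_rpow (ENNReal.div_le_div_left (ENNReal.coe_le_coe.2 htu) _) (hp x)

theorem varNorm_mono (hp : ∀ x, 0 ≤ p x) (hgh : ∀ᵐ x, g x ≤ h x) :
    varNorm p g ≤ varNorm p h :=
  le_iInf fun t => le_iInf fun ht => le_iInf fun hm =>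
    varNorm_le ht ((modular_mono hp hgh t).trans hm)

theorem modular_const_mul {c t : ℝ≥0} (hc : c ≠ 0) :
    modular p (fun x => c * g x) (c * t) = modular p g t := by
  refine lintegral_congr fun x => ?_
  rw [ENNReal.coe_mul, ENNReal.mul_div_mul_left _ _ (by simpa using hc) ENNReal.coe_ne_top]

theorem varNorm_const_mul_le {c : ℝ≥0} (hc : c ≠ 0) :
    varNorm p (fun x => c * g x) ≤ c * varNorm p g :=
  le_mul_varNorm hc fun t ht hm => by
    rw [← ENNReal.coe_mul]
    exact varNorm_le (mul_pos hc.bot_lt ht) ((modular_const_mul hc).trans_le hm)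

theorem modular_indicator {Q : Set (Rn n)} (hQ : MeasurableSet Q) (hp : ∀ x, 0 < p x) (t : ℝ≥0) :
    modular p (Q.indicator g) t = ∫⁻ x in Q, (g x / t) ^ p x := by
  rw [modular, ← lintegral_indicator hQ]
  refine lintegral_congr fun x => ?_
  by_cases hx : x ∈ Q
  · simp [hx]
  · simp [hx, ENNReal.zero_rpow_of_pos (hp x)]

theorem varNorm_indicator_one_ne_top {Q : Set (Rn n)} (hQ : IsCube Q) (hp : ∀ x, 1 ≤ p x) :
    varNorm p (Q.indicator fun _ => 1) ≠ ⊤ := by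
  have hp0 : ∀ x, 0 < p x := fun x => zero_lt_one.trans_le (hp x)
  set t : ℝ≥0 := max 1 (volume Q).toNNReal with ht
  have ht1 : 1 ≤ t := le_max_left _ _
  have htp : 0 < t := zero_lt_one.trans_le ht1
  refine ne_top_of_le_ne_top ENNReal.coe_ne_top (varNorm_le htp ?_)
  rw [modular_indicator hQ.measurableSet hp0]
  have htt : (t : ℝ≥0∞) ≠ 0 := by simpa using htp.ne'
  calc ∫⁻ x in Q, ((1 : ℝ≥0∞) / t) ^ p x ≤ ∫⁻ _x in Q, (1 : ℝ≥0∞) / t := by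
        refine lintegral_mono fun x => ?_
        refine (ENNReal.rpow_le_rpow_of_exponent_ge ?_ (hp x)).trans_eq (ENNReal.rpow_one _)
        rw [ENNReal.div_le_iff htt ENNReal.coe_ne_top, one_mul]
        exact_mod_cast ht1
    _ = 1 / t * volume Q := by simp
    _ ≤ 1 := by
        rw [mul_comm, mul_one_div, ENNReal.div_le_iff htt ENNReal.coe_ne_top, one_mul,
          ← ENNReal.coe_toNNReal hQ.volume_ne_top]
        exact_mod_cast le_max_right _ _

theorem varNorm_indicator_one_ne_zero {Q : Set (Rn n)} (hQ : IsCube Q) (hp : ∀ x, 1 ≤ p x) :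
    varNorm p (Q.indicator fun _ => 1) ≠ 0 := by
  have hp0 : ∀ x, 0 < p x := fun x => zero_lt_one.trans_le (hp x)
  have h0 : 0 < min 1 (volume Q) := lt_min zero_lt_one (pos_iff_ne_zero.2 hQ.volume_ne_zero)
  intro h
  obtain ⟨t, ht, htc, hm⟩ := exists_modular_le_of_varNorm_lt (h.trans_lt h0)
  have htt : (t : ℝ≥0∞) ≠ 0 := by simpa using ht.ne'
  rw [modular_indicator hQ.measurableSet hp0] at hm
  have : 1 / (t : ℝ≥0∞) * volume Q ≤ 1 := by
    calc 1 / (t : ℝ≥0∞) * volume Q = ∫⁻ _x in Q, (1 : ℝ≥0∞) / t := by simp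
      _ ≤ ∫⁻ x in Q, ((1 : ℝ≥0∞) / t) ^ p x := by
        refine lintegral_mono fun x => ?_
        refine (ENNReal.rpow_one _).symm.trans_le
          (ENNReal.rpow_le_rpow_of_exponent_le ?_ (hp x))
        rw [ENNReal.le_div_iff_mul_le (Or.inl htt) (Or.inl ENNReal.coe_ne_top), one_mul]
        exact (htc.trans_le (min_le_left _ _)).le
      _ ≤ 1 := hm
  rw [mul_comm, mul_one_div, ENNReal.div_le_iff htt ENNReal.coe_ne_top, one_mul] at this
  exact absurd (htc.trans_le (min_le_right _ _)) this.not_gt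

end varNorm

/-! ### The maximal theorem on `L²` -/

section Maximal

variable {n : ℕ}

/-- The uncentred Hardy-Littlewood maximal function over open Euclidean balls. -/
def ballMax (f : Rn n → ℝ≥0∞) (x : Rn n) : ℝ≥0∞ :=
  ⨆ (z : Rn n) (r : ℝ) (_ : 0 < r) (_ : x ∈ Metric.ball z r),
    (∫⁻ y in Metric.ball z r, f y) / volume (Metric.ball z r)

theorem volume_ball_pow (z : Rn n) {r : ℝ} (hr : 0 < r) :
    volume (Metric.ball z r) = ENNReal.ofReal (r ^ n) * volume (Metric.ball (0 : Rn n) 1) := by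
  rw [Measure.addHaar_ball_of_pos _ _ hr, finrank_euclideanSpace_fin]

theorem volume_ball_ne_zero (z : Rn n) {r : ℝ} (hr : 0 < r) :
    volume (Metric.ball z r) ≠ 0 := (Metric.measure_ball_pos _ z hr).ne'

theorem lt_ballMax_iff {f : Rn n → ℝ≥0∞} {x : Rn n} {t : ℝ≥0∞} :
    t < ballMax f x ↔ ∃ (z : Rn n) (r : ℝ), 0 < r ∧ x ∈ Metric.ball z r ∧
      t * volume (Metric.ball z r) < ∫⁻ y in Metric.ball z r, f y := by
  simp only [ballMax, lt_iSup_iff, exists_prop]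
  refine exists_congr fun z => exists_congr fun r => and_congr_right fun hr =>
    and_congr_right fun _ => ?_
  rw [ENNReal.lt_div_iff_mul_lt (Or.inl (volume_ball_ne_zero z hr))
    (Or.inl Metric.isBounded_ball.measure_lt_top.ne)]

theorem isOpen_lt_ballMax (f : Rn n → ℝ≥0∞) (t : ℝ≥0∞) : IsOpen {x | t < ballMax f x} := by
  refine isOpen_iff_mem_nhds.2 fun x hx => ?_
  obtain ⟨z, r, hr, hxz, h⟩ := lt_ballMax_iff.1 hx
  filter_upwards [Metric.isOpen_ball.mem_nhds hxz] with y hy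
  exact lt_ballMax_iff.2 ⟨z, r, hr, hy, h⟩

theorem measurable_ballMax (f : Rn n → ℝ≥0∞) : Measurable (ballMax f) :=
  measurable_of_Ioi fun t => (isOpen_lt_ballMax f t).measurableSet

/-- The weak type `(1, 1)` inequality. -/
theorem volume_lt_ballMax_le (hn : n ≠ 0) {f : Rn n → ℝ≥0∞} {t : ℝ≥0∞} (ht : t ≠ 0) (ht' : t ≠ ⊤) :
    volume {x | t < ballMax f x} ≤ 4 ^ n / t * ∫⁻ y, f y := by
  by_cases hf : ∫⁻ y, f y = ⊤
  · rw [hf, ENNReal.mul_top]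
    · exact le_top
    · exact (ENNReal.div_pos (by positivity) ht').ne'
  set S : Set (Rn n × ℝ) := {a | 0 < a.2 ∧
    t * volume (Metric.ball a.1 a.2) < ∫⁻ y in Metric.ball a.1 a.2, f y} with hS
  set v := volume (Metric.ball (0 : Rn n) 1)
  have hv0 : v ≠ 0 := volume_ball_ne_zero _ one_pos
  have hvt : v ≠ ⊤ := Metric.isBounded_ball.measure_lt_top.ne
  have hR : ∀ a ∈ S, a.2 ≤ max 1 ((∫⁻ y, f y) / (t * v)).toReal := fun a ha => by
    by_cases h1 : a.2 ≤ 1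
    · exact h1.trans (le_max_left _ _)
    refine le_trans ?_ (le_max_right _ _)
    refine (le_self_pow₀ (le_of_not_ge h1) hn).trans ?_
    refine (ENNReal.ofReal_le_iff_le_toReal (ENNReal.div_ne_top hf (mul_ne_zero ht hv0))).1 ?_
    rw [ENNReal.le_div_iff_mul_le (Or.inl (mul_ne_zero ht hv0))
      (Or.inl (ENNReal.mul_ne_top ht' hvt)), mul_left_comm, ← volume_ball_pow _ ha.1]
    exact ha.2.le.trans (setLIntegral_le_lintegral _ _)
  obtain ⟨u, huS, hud, hu⟩ := Vitali.exists_disjoint_subfamily_covering_enlargement_ball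
    S Prod.fst Prod.snd _ hR 4 (by norm_num)
  have huc : u.Countable := hud.countable_of_isOpen (fun a _ => Metric.isOpen_ball)
    fun a ha => Metric.nonempty_ball.2 (huS ha).1
  have := huc.to_subtype
  calc volume {x | t < ballMax f x}
      ≤ volume (⋃ a ∈ u, Metric.ball a.1 (4 * a.2)) := by
        refine measure_mono fun x hx => ?_
        obtain ⟨z, r, hr, hxz, h⟩ := lt_ballMax_iff.1 hx
        obtain ⟨c, hc, hzc⟩ := hu (z, r) ⟨hr, h⟩
        exact Set.mem_iUnion₂.2 ⟨c, hc, hzc hxz⟩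
    _ ≤ ∑' a : u, volume (Metric.ball a.1.1 (4 * a.1.2)) := measure_biUnion_le _ huc _
    _ ≤ ∑' a : u, 4 ^ n / t * ∫⁻ y in Metric.ball a.1.1 a.1.2, f y := by
        refine ENNReal.tsum_le_tsum fun a => ?_
        have ha := huS a.2
        have h4 : volume (Metric.ball a.1.1 (4 * a.1.2)) =
            4 ^ n * volume (Metric.ball a.1.1 a.1.2) := by
          rw [volume_ball_pow _ ha.1, volume_ball_pow _ (mul_pos four_pos ha.1), mul_pow,
            ENNReal.ofReal_mul (by positivity), ENNReal.ofReal_pow (by norm_num), mul_assoc]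
          simp
        rw [h4, ENNReal.mul_comm_div]
        gcongr
        rw [ENNReal.le_div_iff_mul_le (Or.inl ht) (Or.inl ht'), mul_comm]
        exact ha.2.le
    _ = 4 ^ n / t * ∑' a : u, ∫⁻ y in Metric.ball a.1.1 a.1.2, f y := ENNReal.tsum_mul_left
    _ = 4 ^ n / t * ∫⁻ y in ⋃ a ∈ u, Metric.ball a.1 a.2, f y := by
        rw [lintegral_biUnion huc (fun a _ => measurableSet_ball) hud]
    _ ≤ 4 ^ n / t * ∫⁻ y, f y := by
        gcongr
        exact Measure.restrict_le_self

theorem sq_le_lintegral_indicator_lt (a : ℝ≥0∞) :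
    a ^ 2 ≤ ∫⁻ t in Set.Ioi (0 : ℝ),
      {t : ℝ | ENNReal.ofReal t < a}.indicator (fun t => ENNReal.ofReal (2 * t)) t := by
  have key : ∀ b : ℝ≥0, (b : ℝ≥0∞) ≤ a → (b : ℝ≥0∞) ^ 2 ≤ ∫⁻ t in Set.Ioi (0 : ℝ),
      {t : ℝ | ENNReal.ofReal t < a}.indicator (fun t => ENNReal.ofReal (2 * t)) t := by
    intro b hb
    have hb' : ((b : ℝ≥0∞)) ^ 2 = ∫⁻ t in Set.Ioc (0 : ℝ) b, ENNReal.ofReal (2 * t) := by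
      rw [← ofReal_integral_eq_lintegral_ofReal, ← intervalIntegral.integral_of_le b.coe_nonneg,
        intervalIntegral.integral_const_mul, integral_id]
      · rw [← ENNReal.ofReal_coe_nnreal, ← ENNReal.ofReal_pow b.coe_nonneg]
        congr 1
        ring
      · exact (intervalIntegrable_iff_integrableOn_Ioc_of_le b.2).1
          (Continuous.intervalIntegrable (by fun_prop) _ _)
      · refine (ae_restrict_iff' measurableSet_Ioc).2 (Filter.Eventually.of_forall fun t ht => ?_)
        simpa using ht.1.le
    rw [hb', ← restrict_Ioo_eq_restrict_Ioc]
    calc ∫⁻ t in Set.Ioo (0 : ℝ) b, ENNReal.ofReal (2 * t)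
        ≤ ∫⁻ t in Set.Ioo (0 : ℝ) b,
          {t : ℝ | ENNReal.ofReal t < a}.indicator (fun t => ENNReal.ofReal (2 * t)) t := by
          refine setLIntegral_mono' measurableSet_Ioo fun t ht => ?_
          rw [Set.indicator_of_mem]
          refine lt_of_lt_of_le ?_ hb
          rw [← ENNReal.ofReal_coe_nnreal]
          exact (ENNReal.ofReal_lt_ofReal_iff (ht.1.trans ht.2)).2 ht.2
      _ ≤ _ := lintegral_mono_set Set.Ioo_subset_Ioi_self
  induction a with
  | coe a => exact key a le_rfl
  | top =>
    refine le_of_le_of_eq le_top (ENNReal.eq_top_of_forall_nnreal_le fun r => ?_).symm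
    refine le_trans ?_ (key (NNReal.sqrt r) le_top)
    rw [← ENNReal.coe_pow, NNReal.sq_sqrt]

theorem lintegral_indicator_lt_le (a : ℝ≥0∞) :
    ∫⁻ t in Set.Ioi (0 : ℝ), {t : ℝ | ENNReal.ofReal t < a}.indicator 1 t ≤ a := by
  induction a with
  | top => exact le_top
  | coe a =>
    rw [lintegral_indicator_one (measurableSet_lt ENNReal.measurable_ofReal measurable_const),
      Measure.restrict_apply (measurableSet_lt ENNReal.measurable_ofReal measurable_const)]
    calc volume ({t : ℝ | ENNReal.ofReal t < a} ∩ Set.Ioi 0) ≤ volume (Set.Ioo (0 : ℝ) a) := by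
          refine measure_mono fun t ht => ⟨ht.2, ?_⟩
          have h1 : ENNReal.ofReal t < a := ht.1
          rw [← ENNReal.ofReal_coe_nnreal] at h1
          exact ((ENNReal.ofReal_lt_ofReal_iff_of_nonneg (le_of_lt ht.2)).1 h1)
      _ = a := by simp

theorem volume_lt_ballMax_le_truncated (hn : n ≠ 0) {f : Rn n → ℝ≥0∞} (hf : Measurable f)
    {t : ℝ≥0∞} (ht : t ≠ 0) (ht' : t ≠ ⊤) :
    volume {x | t < ballMax f x} ≤ 2 * 4 ^ n / t * ∫⁻ y, {y | t < 2 * f y}.indicator f y := by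
  have hm : MeasurableSet {y | t < 2 * f y} := measurableSet_lt measurable_const (hf.const_mul 2)
  have h2 : t / 2 ≠ 0 := by simpa using ht
  have h2' : t / 2 ≠ ⊤ := ENNReal.div_ne_top ht' two_ne_zero
  calc volume {x | t < ballMax f x}
      ≤ volume {x | t / 2 < ballMax ({y | t < 2 * f y}.indicator f) x} := by
        refine measure_mono fun x hx => ?_
        obtain ⟨z, r, hr, hxz, h⟩ := lt_ballMax_iff.1 hx
        refine lt_ballMax_iff.2 ⟨z, r, hr, hxz, ?_⟩
        set B := Metric.ball z r
        have hB : t / 2 * volume B ≠ ⊤ :=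
          ENNReal.mul_ne_top h2' Metric.isBounded_ball.measure_lt_top.ne
        refine lt_of_add_lt_add_right (a := t / 2 * volume B) ?_
        rw [← add_mul, ENNReal.add_halves]
        refine h.trans_le ?_
        calc ∫⁻ y in B, f y ≤ ∫⁻ y in B, ({y | t < 2 * f y}.indicator f y + t / 2) := by
              refine lintegral_mono fun y => ?_
              by_cases hy : t < 2 * f y
              · rw [Set.indicator_of_mem (show y ∈ {y | t < 2 * f y} from hy)]
                exact le_self_add
              · refine le_trans ?_ le_add_self
                rw [ENNReal.le_div_iff_mul_le (by simp) (by simp), mul_comm]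
                exact not_lt.1 hy
          _ = _ := by
              rw [lintegral_add_right _ measurable_const, setLIntegral_const]
    _ ≤ 4 ^ n / (t / 2) * ∫⁻ y, {y | t < 2 * f y}.indicator f y := volume_lt_ballMax_le hn h2 h2'
    _ = _ := by
        congr 1
        rw [div_eq_mul_inv t 2, ENNReal.div_eq_inv_mul, ENNReal.mul_inv (by simp) (by simp),
          inv_inv, ENNReal.div_eq_inv_mul, mul_assoc]

/-- The Hardy-Littlewood maximal theorem on `L²`. -/
theorem lintegral_ballMax_sq_le (hn : n ≠ 0) {f : Rn n → ℝ≥0∞} (hf : Measurable f) :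
    ∫⁻ x, ballMax f x ^ 2 ≤ 8 * 4 ^ n * ∫⁻ x, f x ^ 2 := by
  have hM := measurable_ballMax f
  calc ∫⁻ x, ballMax f x ^ 2
      ≤ ∫⁻ x, ∫⁻ t in Set.Ioi (0 : ℝ),
        {t : ℝ | ENNReal.ofReal t < ballMax f x}.indicator (fun t => ENNReal.ofReal (2 * t)) t :=
        lintegral_mono fun x => sq_le_lintegral_indicator_lt _
    _ = ∫⁻ t in Set.Ioi (0 : ℝ), ∫⁻ x,
        {x | ENNReal.ofReal t < ballMax f x}.indicator (fun _ => ENNReal.ofReal (2 * t)) x := by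
        rw [lintegral_lintegral_swap]
        · rfl
        · refine Measurable.aemeasurable ?_
          exact Measurable.indicator (f := fun z : Rn n × ℝ => ENNReal.ofReal (2 * z.2))
            (s := {z : Rn n × ℝ | ENNReal.ofReal z.2 < ballMax f z.1})
            (by fun_prop) (measurableSet_lt (by fun_prop) (hM.comp measurable_fst))
    _ ≤ ∫⁻ t in Set.Ioi (0 : ℝ), 4 * 4 ^ n * ∫⁻ x, {x | ENNReal.ofReal t < 2 * f x}.indicator f x := by
        refine setLIntegral_mono' measurableSet_Ioi fun t ht => ?_
        have ht0 : ENNReal.ofReal t ≠ 0 := by simpa using ht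
        rw [lintegral_indicator_const (isOpen_lt_ballMax f _).measurableSet]
        calc ENNReal.ofReal (2 * t) * volume {x | ENNReal.ofReal t < ballMax f x}
            ≤ ENNReal.ofReal (2 * t) * (2 * 4 ^ n / ENNReal.ofReal t *
              ∫⁻ x, {x | ENNReal.ofReal t < 2 * f x}.indicator f x) := by
              gcongr
              exact volume_lt_ballMax_le_truncated hn hf ht0 ENNReal.ofReal_ne_top
          _ = _ := by
              rw [← mul_assoc, ENNReal.ofReal_mul zero_le_two, mul_div_assoc', mul_comm,
                mul_comm (4 * 4 ^ n : ℝ≥0∞)]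
              congr 1
              rw [mul_right_comm, ← mul_assoc, ENNReal.mul_div_cancel_right ht0 ENNReal.ofReal_ne_top]
              norm_num
    _ = 4 * 4 ^ n * ∫⁻ x, ∫⁻ t in Set.Ioi (0 : ℝ),
          f x * {t : ℝ | ENNReal.ofReal t < 2 * f x}.indicator 1 t := by
        rw [lintegral_const_mul' _ _ (by finiteness), lintegral_lintegral_swap]
        · congr 1
          refine lintegral_congr fun x => lintegral_congr fun t => ?_
          simp [Set.indicator]
        · refine Measurable.aemeasurable ?_
          exact Measurable.indicator (f := fun z : ℝ × Rn n => f z.2)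
            (s := {z : ℝ × Rn n | ENNReal.ofReal z.1 < 2 * f z.2})
            (hf.comp measurable_snd)
            (measurableSet_lt (by fun_prop) ((hf.comp measurable_snd).const_mul 2))
    _ ≤ 4 * 4 ^ n * ∫⁻ x, 2 * f x ^ 2 := by
        gcongr with x
        rw [lintegral_const_mul _ (measurable_one.indicator
          (measurableSet_lt ENNReal.measurable_ofReal measurable_const))]
        calc _ ≤ f x * (2 * f x) := by gcongr; exact lintegral_indicator_lt_le _
          _ = 2 * f x ^ 2 := by ring
    _ = 8 * 4 ^ n * ∫⁻ x, f x ^ 2 := by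
        rw [lintegral_const_mul _ (hf.pow_const 2), ← mul_assoc]
        congr 1
        rw [mul_right_comm]
        norm_num

theorem ballMax_congr {f g : Rn n → ℝ≥0∞} (h : f =ᵐ[volume] g) : ballMax f = ballMax g := by
  funext x
  refine iSup_congr fun z => iSup_congr fun r => iSup_congr fun _ => iSup_congr fun _ => ?_
  rw [lintegral_congr_ae (ae_restrict_of_ae h)]

theorem exists_fracMax_zero_le_ballMax (n : ℕ) : ∃ K : ℝ≥0, 0 < K ∧ ∀ (f : Rn n → ℝ) (x : Rn n),
    fracMax 0 f x ≤ K * ballMax (fun y => ‖f y‖ₑ) x := by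
  set v := volume (Metric.ball (0 : Rn n) 1)
  have hv0 : v ≠ 0 := volume_ball_ne_zero _ one_pos
  have hvt : v ≠ ⊤ := Metric.isBounded_ball.measure_lt_top.ne
  have hn1 : 0 < √n + 1 := by positivity
  have hKt : ENNReal.ofReal ((√n + 1) ^ n) * v ≠ ⊤ := by finiteness
  have hK0 : ENNReal.ofReal ((√n + 1) ^ n) * v ≠ 0 :=
    mul_ne_zero (by simpa using pow_pos hn1 n) hv0
  refine ⟨(ENNReal.ofReal ((√n + 1) ^ n) * v).toNNReal, ENNReal.toNNReal_pos hK0 hKt,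
    fun f x => ?_⟩
  rw [ENNReal.coe_toNNReal hKt]
  refine iSup_le fun Q => iSup_le fun hQ => iSup_le fun hx => ?_
  obtain ⟨a, r, hr, rfl⟩ := hQ
  rw [← cube] at hx ⊢
  have hsub : cube a r ⊆ Metric.ball x ((√n + 1) * r) :=
    (cube_subset_closedBall hr.le hx).trans (Metric.closedBall_subset_ball (by linarith))
  have hR : 0 < (√n + 1) * r := by positivity
  have hvol : volume (Metric.ball x ((√n + 1) * r)) =
      ENNReal.ofReal ((√n + 1) ^ n) * v * volume (cube a r) := by
    rw [volume_ball_pow _ hR, volume_cube a hr.le, mul_pow, ENNReal.ofReal_mul (by positivity)]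
    ring
  have hc0 : volume (cube a r) ≠ 0 := (isCube_cube a hr).volume_ne_zero
  have hct : volume (cube a r) ≠ ⊤ := (isCube_cube a hr).volume_ne_top
  calc (∫⁻ y in cube a r, ‖f y‖ₑ) / volume (cube a r) ^ (1 - 0 / (n : ℝ))
      ≤ (∫⁻ y in Metric.ball x ((√n + 1) * r), ‖f y‖ₑ) / volume (cube a r) := by
        rw [zero_div, sub_zero, ENNReal.rpow_one]
        gcongr
    _ = ENNReal.ofReal ((√n + 1) ^ n) * v * ((∫⁻ y in Metric.ball x ((√n + 1) * r), ‖f y‖ₑ) /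
          volume (Metric.ball x ((√n + 1) * r))) := by
        rw [hvol, ← mul_div_assoc, ENNReal.mul_div_mul_left _ _ hK0 hKt]
    _ ≤ _ := by
        gcongr
        exact le_iSup_of_le x (le_iSup_of_le _ (le_iSup_of_le hR
          (le_iSup_of_le (Metric.mem_ball_self hR) le_rfl)))

theorem expP_const {s : ℝ} (hs : 1 < s) : ExpP (fun _ : Rn n => s) := by
  refine ⟨measurable_const, fun _ => hs.le, ?_, ?_⟩
  · rw [essInf_const _ (NeZero.ne _)]
    exact_mod_cast hs
  · rw [essSup_const _ (NeZero.ne _)]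
    exact EReal.coe_lt_top s

theorem expB_two (hn : n ≠ 0) : ExpB (fun _ : Rn n => 2) := by
  refine ⟨expP_const one_lt_two, ?_⟩
  obtain ⟨K, hK0, hK⟩ := exists_fracMax_zero_le_ballMax n
  set A : ℝ≥0 := NNReal.sqrt (8 * 4 ^ n) with hA
  have hA0 : 0 < A := NNReal.sqrt_pos.2 (by positivity)
  have hA2 : (8 * 4 ^ n : ℝ≥0∞) = (A : ℝ≥0∞) ^ 2 := by
    rw [← ENNReal.coe_pow, hA, NNReal.sq_sqrt]
    simp
  have hA0' : (A : ℝ≥0∞) ≠ 0 := by simpa using hA0.ne'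
  refine ⟨K * A, fun f hf => le_mul_varNorm (mul_pos hK0 hA0).ne' fun t ht hm => ?_⟩
  have htt : (t : ℝ≥0∞) ≠ 0 := by simpa using ht.ne'
  rw [← ENNReal.coe_mul]
  refine varNorm_le (mul_pos (mul_pos hK0 hA0) ht) ?_
  refine (modular_mono (fun _ => zero_le_two) (Filter.Eventually.of_forall (hK f)) _).trans ?_
  rw [mul_assoc, modular_const_mul hK0.ne']
  have hfm : AEMeasurable (fun x => ‖f x‖ₑ) volume := hf.1.enorm
  have hdiv : ∀ (g : Rn n → ℝ≥0∞) (u : ℝ≥0), u ≠ 0 →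
      modular (fun _ => 2) g u = (∫⁻ x, g x ^ 2) / (u : ℝ≥0∞) ^ 2 := fun g u hu => by
    have hu' : (u : ℝ≥0∞) ^ 2 ≠ 0 := by simpa using hu
    rw [modular, div_eq_mul_inv, ← lintegral_mul_const' _ _ (ENNReal.inv_ne_top.2 hu')]
    refine lintegral_congr fun x => ?_
    rw [ENNReal.rpow_two, div_eq_mul_inv, mul_pow, ENNReal.inv_pow]
  rw [hdiv _ _ ht.ne'] at hm
  rw [hdiv _ _ (mul_pos hA0 ht).ne', ENNReal.coe_mul, mul_pow, ballMax_congr hfm.ae_eq_mk]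
  refine le_trans (ENNReal.div_le_div_right (lintegral_ballMax_sq_le hn hfm.measurable_mk) _) ?_
  rw [hA2, ENNReal.mul_div_mul_left _ _ (pow_ne_zero 2 hA0') (by finiteness)]
  refine le_of_eq_of_le ?_ hm
  congr 1
  exact lintegral_congr_ae (hfm.ae_eq_mk.symm.mono fun x hx => by simp only [hx])

end Maximal

/-! ### Fractional maximal functions -/

section Fractional

variable {n : ℕ}

theorem volume_cube_rpow_one_sub (hn : n ≠ 0) (a : Rn n) {r : ℝ} (hr : 0 < r) (γ : ℝ) :
    volume (cube a r) ^ (1 - γ / (n : ℝ)) = ENNReal.ofReal (r ^ (n - γ)) := by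
  rw [← volume_cube_rpow hn a hr]
  congr 1
  have : (n : ℝ) ≠ 0 := Nat.cast_ne_zero.2 hn
  field_simp

theorem ofReal_rpow_ne_zero {r : ℝ} (hr : 0 < r) (θ : ℝ) : ENNReal.ofReal (r ^ θ) ≠ 0 := by
  simpa using Real.rpow_pos_of_pos hr θ

theorem fracMax_le_iff (hn : n ≠ 0) {γ : ℝ} {f : Rn n → ℝ} {x : Rn n} {D : ℝ≥0∞} :
    fracMax γ f x ≤ D ↔ ∀ (a : Rn n) (r : ℝ), 0 < r → x ∈ cube a r →
      ∫⁻ y in cube a r, ‖f y‖ₑ ≤ D * ENNReal.ofReal (r ^ (n - γ)) := by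
  simp only [fracMax, iSup_le_iff]
  constructor
  · intro h a r hr hx
    have := h _ (isCube_cube a hr) hx
    rwa [volume_cube_rpow_one_sub hn a hr,
      ENNReal.div_le_iff (ofReal_rpow_ne_zero hr _) ENNReal.ofReal_ne_top] at this
  · rintro h Q ⟨a, r, hr, rfl⟩ hx
    rw [← cube, volume_cube_rpow_one_sub hn a hr,
      ENNReal.div_le_iff (ofReal_rpow_ne_zero hr _) ENNReal.ofReal_ne_top]
    exact h a r hr hx

theorem fracMaxOn_le_iff (hn : n ≠ 0) {γ : ℝ} {Q : Set (Rn n)} {f : Rn n → ℝ} {x : Rn n}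
    {D : ℝ≥0∞} :
    fracMaxOn γ Q f x ≤ D ↔ ∀ (a : Rn n) (r : ℝ), 0 < r → x ∈ cube a r → cube a r ⊆ Q →
      ∫⁻ y in cube a r, ‖f y‖ₑ ≤ D * ENNReal.ofReal (r ^ (n - γ)) := by
  simp only [fracMaxOn, iSup_le_iff]
  constructor
  · intro h a r hr hx hQ
    have := h _ (isCube_cube a hr) hx hQ
    rwa [volume_cube_rpow_one_sub hn a hr,
      ENNReal.div_le_iff (ofReal_rpow_ne_zero hr _) ENNReal.ofReal_ne_top] at this
  · rintro h Q ⟨a, r, hr, rfl⟩ hx hQ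
    rw [← cube, volume_cube_rpow_one_sub hn a hr,
      ENNReal.div_le_iff (ofReal_rpow_ne_zero hr _) ENNReal.ofReal_ne_top]
    exact h a r hr hx hQ

theorem setLIntegral_cube_le_fracMax (hn : n ≠ 0) (γ : ℝ) (f : Rn n → ℝ) {a x : Rn n} {r : ℝ}
    (hr : 0 < r) (hx : x ∈ cube a r) :
    ∫⁻ y in cube a r, ‖f y‖ₑ ≤ fracMax γ f x * ENNReal.ofReal (r ^ (n - γ)) :=
  (fracMax_le_iff hn).1 le_rfl a r hr hx

theorem setLIntegral_cube_le_fracMaxOn (hn : n ≠ 0) (γ : ℝ) (f : Rn n → ℝ) {Q : Set (Rn n)}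
    {a x : Rn n} {r : ℝ} (hr : 0 < r) (hx : x ∈ cube a r) (hQ : cube a r ⊆ Q) :
    ∫⁻ y in cube a r, ‖f y‖ₑ ≤ fracMaxOn γ Q f x * ENNReal.ofReal (r ^ (n - γ)) :=
  (fracMaxOn_le_iff hn).1 le_rfl a r hr hx hQ

theorem fracMax_congr_ae {f g : Rn n → ℝ} (h : f =ᵐ[volume] g) (γ : ℝ) :
    fracMax γ f = fracMax γ g := by
  funext x
  refine iSup_congr fun Q => iSup_congr fun _ => iSup_congr fun _ => ?_
  rw [lintegral_congr_ae (ae_restrict_of_ae (h.mono fun y hy => by rw [hy]))]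

theorem fracMaxOn_congr_ae {f g : Rn n → ℝ} (h : f =ᵐ[volume] g) (γ : ℝ) (Q : Set (Rn n)) :
    fracMaxOn γ Q f = fracMaxOn γ Q g := by
  funext x
  refine iSup_congr fun Q => iSup_congr fun _ => iSup_congr fun _ => iSup_congr fun _ => ?_
  rw [lintegral_congr_ae (ae_restrict_of_ae (h.mono fun y hy => by rw [hy]))]

/-- Hölder's inequality reduces the fractional maximal function to `M`. -/
theorem fracMax_le_mul_fracMax_zero_rpow (hn : n ≠ 0) {γ : ℝ} (hγ₀ : 0 < γ) (hγn : γ < n)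
    {p s : Rn n → ℝ} (hp0 : ∀ x, 0 < p x) (hpm : Measurable p) (hs0 : ∀ x, 0 < s x)
    (hsm : Measurable s)
    (hps : ∀ x, p x * (γ / n) + p x / s x * (1 - γ / n) = 1)
    {f : Rn n → ℝ} (hf : AEMeasurable f volume) {t : ℝ≥0} (ht : 0 < t)
    (hm : modular p (fun x => ‖f x‖ₑ) t ≤ 1) (x : Rn n) :
    fracMax γ f x ≤ t * fracMax 0 (fun y => (|f y| / t) ^ (p y / s y)) x ^ (1 - γ / n) := by
  have htt : (t : ℝ≥0∞) ≠ 0 := by simpa using ht.ne'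
  have hn' : (0 : ℝ) < n := Nat.cast_pos.2 hn.bot_lt
  have hθ0 : 0 < γ / n := by positivity
  have hθ1 : 0 < 1 - γ / n := by rw [sub_pos, div_lt_one hn']; exact hγn
  have hF : AEMeasurable (fun y => ‖f y‖ₑ / t) volume := hf.enorm.div_const _
  have hg : ∀ y, ‖(|f y| / t) ^ (p y / s y)‖ₑ = (‖f y‖ₑ / t) ^ (p y / s y) := fun y => by
    have h0 : 0 ≤ |f y| / t := by positivity
    rw [Real.enorm_eq_ofReal (Real.rpow_nonneg h0 _),
      ← ENNReal.ofReal_rpow_of_nonneg h0 (div_pos (hp0 y) (hs0 y)).le,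
      ENNReal.ofReal_div_of_pos (NNReal.coe_pos.2 ht), ENNReal.ofReal_coe_nnreal,
      ← Real.enorm_eq_ofReal_abs]
  refine (fracMax_le_iff hn).2 fun a r hr hx => ?_
  have h1 : ∫⁻ y in cube a r, ‖f y‖ₑ / t ≤
      (∫⁻ y in cube a r, ‖(|f y| / t) ^ (p y / s y)‖ₑ) ^ (1 - γ / n) := by
    calc ∫⁻ y in cube a r, ‖f y‖ₑ / t
        = ∫⁻ y in cube a r, ((‖f y‖ₑ / t) ^ p y) ^ (γ / n) *
            ‖(|f y| / t) ^ (p y / s y)‖ₑ ^ (1 - γ / n) := by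
          refine lintegral_congr fun y => ?_
          rw [hg, ← ENNReal.rpow_mul, ← ENNReal.rpow_mul, ← ENNReal.rpow_add_of_nonneg, hps,
            ENNReal.rpow_one]
          · exact (mul_pos (hp0 y) hθ0).le
          · exact (mul_pos (div_pos (hp0 y) (hs0 y)) hθ1).le
      _ ≤ (∫⁻ y in cube a r, (‖f y‖ₑ / t) ^ p y) ^ (γ / n) *
            (∫⁻ y in cube a r, ‖(|f y| / t) ^ (p y / s y)‖ₑ) ^ (1 - γ / n) := by
          refine ENNReal.lintegral_mul_norm_pow_le ?_ ?_ hθ0.le hθ1.le (by ring)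
          · exact (hF.pow hpm.aemeasurable).restrict
          · simp only [hg]
            exact (hF.pow (hpm.div hsm).aemeasurable).restrict
      _ ≤ 1 ^ (γ / n) * (∫⁻ y in cube a r, ‖(|f y| / t) ^ (p y / s y)‖ₑ) ^ (1 - γ / n) := by
          gcongr
          exact (setLIntegral_le_lintegral _ _).trans hm
      _ = _ := by rw [ENNReal.one_rpow, one_mul]
  have h2 : ∫⁻ y in cube a r, ‖f y‖ₑ = t * ∫⁻ y in cube a r, ‖f y‖ₑ / t := by
    rw [← lintegral_const_mul' _ _ ENNReal.coe_ne_top]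
    refine lintegral_congr fun y => ?_
    rw [ENNReal.mul_div_cancel htt ENNReal.coe_ne_top]
  rw [h2, mul_assoc]
  gcongr
  refine h1.trans ?_
  refine (ENNReal.rpow_le_rpow (setLIntegral_cube_le_fracMax hn 0 _ hr hx) hθ1.le).trans_eq ?_
  rw [ENNReal.mul_rpow_of_nonneg _ _ hθ1.le, sub_zero,
    ENNReal.ofReal_rpow_of_pos (Real.rpow_pos_of_pos hr _), ← Real.rpow_mul hr.le]
  congr 3
  field_simp

theorem ExpPair.one_le_left {γ : ℝ} {p q : Rn n → ℝ} (h : ExpPair γ p q) (x : Rn n) : 1 ≤ p x :=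
  h.1.2.1 x

theorem ExpPair.right_pos {γ : ℝ} (hγn : γ < n) {p q : Rn n → ℝ} (h : ExpPair γ p q) (x : Rn n) :
    0 < q x := by
  have h1 : 1 ≤ q x * ((n : ℝ) - γ) / n := h.2.2.2.1.2.1 x
  by_contra hq
  have : q x * ((n : ℝ) - γ) / n ≤ 0 :=
    div_nonpos_of_nonpos_of_nonneg
      (mul_nonpos_of_nonpos_of_nonneg (not_lt.1 hq) (sub_pos.2 hγn).le) n.cast_nonneg
  linarith

theorem ExpPair.mul_add_div {γ : ℝ} (hγn : γ < n) {p q : Rn n → ℝ} (h : ExpPair γ p q)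
    (x : Rn n) : p x * (γ / n) + p x / q x = 1 := by
  have hq := (h.right_pos hγn x).ne'
  have hp := (zero_lt_one.trans_le (h.one_le_left x)).ne'
  have h1 := h.2.2.1 x
  calc p x * (γ / n) + p x / q x = p x * (γ / n + 1 / q x) := by ring
    _ = 1 := by rw [h1]; field_simp; ring

/-- The fractional maximal operator is bounded for every admissible pair of exponents. -/
theorem ExpPair.varNorm_fracMax_le (hn : n ≠ 0) {γ : ℝ} (hγ₀ : 0 < γ) (hγn : γ < n)
    {p q : Rn n → ℝ} (h : ExpPair γ p q) : ∃ C : ℝ≥0, 0 < C ∧ ∀ f : Rn n → ℝ,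
      AEMeasurable f volume → varNorm q (fracMax γ f) ≤ C * varNorm p (fun x => ‖f x‖ₑ) := by
  have hn' : (0 : ℝ) < n := Nat.cast_pos.2 hn.bot_lt
  have hθ1 : 0 < 1 - γ / n := by rw [sub_pos, div_lt_one hn']; exact hγn
  set s : Rn n → ℝ := fun x => q x * ((n : ℝ) - γ) / n with hs
  have hsq : ∀ x, s x = (1 - γ / n) * q x := fun x => by
    simp only [hs]; field_simp
  obtain ⟨⟨hsm, hs1, -⟩, C, hC⟩ := h.2.2.2
  have hs0 : ∀ x, 0 < s x := fun x => zero_lt_one.trans_le (hs1 x)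
  have hq0 := h.right_pos hγn
  have hp0 : ∀ x, 0 < p x := fun x => zero_lt_one.trans_le (h.one_le_left x)
  have hps : ∀ x, p x * (γ / n) + p x / s x * (1 - γ / n) = 1 := fun x => by
    refine Eq.trans ?_ (h.mul_add_div hγn x)
    rw [hsq, mul_comm (1 - γ / n) (q x), div_mul_eq_mul_div, mul_div_mul_right _ _ hθ1.ne']
  set c : ℝ≥0 := C + 1 with hc
  have hc0 : 0 < c := by positivity
  have hc0' : (c : ℝ≥0∞) ≠ 0 := by simpa using hc0.ne'
  have hcθ : (0 : ℝ≥0) < c ^ (1 - γ / n) := NNReal.rpow_pos hc0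
  refine ⟨c ^ (1 - γ / n), hcθ, fun f hf => le_mul_varNorm hcθ.ne' fun t ht hm => ?_⟩
  have htt : (t : ℝ≥0∞) ≠ 0 := by simpa using ht.ne'
  set g : Rn n → ℝ := fun y => (|f y| / t) ^ (p y / s y) with hg
  have hgm : AEMeasurable g volume :=
    ((measurable_norm.comp_aemeasurable hf).div_const _).pow (h.1.1.div hsm).aemeasurable
  have hg1 : modular s (fun x => ‖g x‖ₑ) 1 ≤ 1 := by
    refine le_of_eq_of_le (lintegral_congr fun y => ?_) hm
    have h0 : 0 ≤ |f y| / t := by positivity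
    change (‖(|f y| / t) ^ (p y / s y)‖ₑ / ((1 : ℝ≥0) : ℝ≥0∞)) ^ s y = (‖f y‖ₑ / t) ^ p y
    rw [ENNReal.coe_one, div_one, Real.enorm_eq_ofReal (Real.rpow_nonneg h0 _),
      ← ENNReal.ofReal_rpow_of_nonneg h0 (div_pos (hp0 y) (hs0 y)).le,
      ENNReal.ofReal_div_of_pos (NNReal.coe_pos.2 ht), ENNReal.ofReal_coe_nnreal,
      ← Real.enorm_eq_ofReal_abs, ← ENNReal.rpow_mul, div_mul_cancel₀ _ (hs0 y).ne']
  have hMg : varNorm s (fracMax 0 g) < c := by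
    refine (hC g ⟨hgm, 1, one_pos, hg1.trans_lt ENNReal.one_lt_top⟩).trans_lt ?_
    calc (C : ℝ≥0∞) * varNorm s (fun x => ‖g x‖ₑ) ≤ C * 1 := by
          gcongr
          exact_mod_cast varNorm_le one_pos hg1
      _ < c := by
          rw [mul_one, hc]
          exact_mod_cast lt_add_one C
  obtain ⟨u, -, huc, hu⟩ := exists_modular_le_of_varNorm_lt hMg
  have hcm : modular s (fracMax 0 g) c ≤ 1 :=
    (modular_anti (fun x => (hs0 x).le) (ENNReal.coe_le_coe.1 huc.le)).trans hu
  rw [← ENNReal.coe_mul]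
  refine varNorm_le (mul_pos hcθ ht) (le_trans (lintegral_mono fun x => ?_) hcm)
  calc (fracMax γ f x / ((c ^ (1 - γ / n) * t : ℝ≥0) : ℝ≥0∞)) ^ q x
      ≤ (t * fracMax 0 g x ^ (1 - γ / n) / ((c ^ (1 - γ / n) * t : ℝ≥0) : ℝ≥0∞)) ^ q x := by
        refine ENNReal.rpow_le_rpow ?_ (hq0 x).le
        gcongr
        exact fracMax_le_mul_fracMax_zero_rpow hn hγ₀ hγn hp0 h.1.1 hs0 hsm hps hf ht hm x
    _ = (fracMax 0 g x / c) ^ s x := by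
        rw [hsq, ENNReal.rpow_mul, ENNReal.div_rpow_of_nonneg _ _ hθ1.le, mul_comm _ t,
          ENNReal.coe_mul, ENNReal.mul_div_mul_left _ _ htt ENNReal.coe_ne_top,
          ENNReal.coe_rpow_of_ne_zero hc0.ne']

end Fractional

/-! ### Pointwise bounds for Lipschitz symbols -/

section Pointwise

variable {n : ℕ}

theorem MemVarLp.locallyIntegrable {p : Rn n → ℝ} (hp : ∀ x, 1 ≤ p x) {f : Rn n → ℝ}
    (hf : MemVarLp p f) : LocallyIntegrable f volume := by
  obtain ⟨hfm, t, ht, hm⟩ := hf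
  have htt : (t : ℝ≥0∞) ≠ 0 := by simpa using ht.ne'
  refine locallyIntegrable_iff.2 fun K hK => ⟨hfm.aestronglyMeasurable.restrict, ?_⟩
  calc ∫⁻ x in K, ‖f x‖ₑ ≤ ∫⁻ x in K, t * (1 + (‖f x‖ₑ / t) ^ p x) := by
        refine lintegral_mono fun x => ?_
        calc ‖f x‖ₑ = t * (‖f x‖ₑ / t) := (ENNReal.mul_div_cancel htt ENNReal.coe_ne_top).symm
          _ ≤ t * (1 + (‖f x‖ₑ / t) ^ p x) := by
            gcongr
            by_cases h1 : ‖f x‖ₑ / t ≤ 1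
            · exact h1.trans le_self_add
            · refine le_trans ?_ le_add_self
              exact (ENNReal.rpow_one _).symm.trans_le
                (ENNReal.rpow_le_rpow_of_exponent_le (not_le.1 h1).le (hp x))
    _ = t * (volume K + ∫⁻ x in K, (‖f x‖ₑ / t) ^ p x) := by
        rw [lintegral_const_mul' _ _ ENNReal.coe_ne_top, lintegral_add_left measurable_const]
        simp
    _ < ⊤ := by
        refine ENNReal.mul_lt_top ENNReal.coe_lt_top (ENNReal.add_lt_top.2 ⟨hK.measure_lt_top, ?_⟩)
        exact (setLIntegral_le_lintegral _ _).trans_lt hm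

/-- Almost everywhere, the averages over small cubes are bounded. -/
theorem ae_exists_setLIntegral_cube_le (hn : n ≠ 0) {f : Rn n → ℝ}
    (hf : LocallyIntegrable f volume) : ∀ᵐ x, ∃ δ : ℝ, 0 < δ ∧ ∃ K : ℝ≥0,
      ∀ (a : Rn n) (r : ℝ), 0 < r → r < δ → x ∈ cube a r →
        ∫⁻ y in cube a r, ‖f y‖ₑ ≤ K * ENNReal.ofReal (r ^ n) := by
  have hn' : (0 : ℝ) < √n := Real.sqrt_pos.2 (Nat.cast_pos.2 hn.bot_lt)
  filter_upwards [IsUnifLocDoublingMeasure.ae_tendsto_average volume (fun y => (hf y).norm :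
    LocallyIntegrable (fun y => ‖f y‖) volume) 0] with x hx
  have h1 := hx (fun _ : ℝ => x) id (l := nhdsWithin 0 (Set.Ioi 0)) Filter.tendsto_id
    (Filter.Eventually.of_forall fun r => by simp)
  have h2 := h1.eventually_le_const (lt_add_one ‖f x‖)
  obtain ⟨ε, hε, h3⟩ := (mem_nhdsGT_iff_exists_Ioo_subset).1 h2
  set v := volume.real (Metric.ball (0 : Rn n) 1)
  refine ⟨ε / √n, div_pos hε hn', ((‖f x‖ + 1) * (√n ^ n * v)).toNNReal,
    fun a r hr hrδ hxr => ?_⟩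
  have hR : 0 < √n * r := by positivity
  have h4 : ⨍ y in Metric.closedBall x (√n * r), ‖f y‖ ≤ ‖f x‖ + 1 :=
    h3 ⟨hR, by rwa [mul_comm, ← lt_div_iff₀ hn']⟩
  have hint : IntegrableOn f (Metric.closedBall x (√n * r)) :=
    hf.integrableOn_isCompact (isCompact_closedBall _ _)
  have hvol : volume.real (Metric.closedBall x (√n * r)) = √n ^ n * v * r ^ n := by
    rw [Measure.addHaar_real_closedBall _ _ hR.le, finrank_euclideanSpace_fin]
    ring
  have hv : 0 < volume.real (Metric.closedBall x (√n * r)) :=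
    ENNReal.toReal_pos (Metric.measure_closedBall_pos _ x hR).ne'
      Metric.isBounded_closedBall.measure_lt_top.ne
  rw [setAverage_eq, smul_eq_mul, inv_mul_le_iff₀ hv, hvol] at h4
  calc ∫⁻ y in cube a r, ‖f y‖ₑ ≤ ∫⁻ y in Metric.closedBall x (√n * r), ‖f y‖ₑ :=
        lintegral_mono_set (cube_subset_closedBall hr.le hxr)
    _ = ENNReal.ofReal (∫ y in Metric.closedBall x (√n * r), ‖f y‖) :=
        (ofReal_integral_norm_eq_lintegral_enorm hint).symm
    _ ≤ ENNReal.ofReal ((‖f x‖ + 1) * (√n ^ n * v) * r ^ n) := by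
        refine ENNReal.ofReal_le_ofReal (h4.trans_eq ?_)
        ring
    _ = _ := by
        rw [ENNReal.ofReal_mul (by positivity)]
        rfl

theorem ae_fracMax_lt_top_of_le (hn : n ≠ 0) {α γ : ℝ} (hα : 0 ≤ α) (hαγ : α ≤ γ) {f : Rn n → ℝ}
    (hf : LocallyIntegrable f volume) :
    ∀ᵐ x, fracMax γ f x < ⊤ → fracMax α f x < ⊤ := by
  filter_upwards [ae_exists_setLIntegral_cube_le hn hf] with x hx hγx
  obtain ⟨δ, hδ, K, hK⟩ := hx
  refine lt_of_le_of_lt ((fracMax_le_iff hn (D := K * ENNReal.ofReal (δ ^ α) +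
    fracMax γ f x * ENNReal.ofReal (δ ^ (α - γ)))).2 fun a r hr hxr => ?_) ?_
  · rcases lt_or_ge r δ with hrδ | hrδ
    · refine (hK a r hr hrδ hxr).trans ?_
      calc (K : ℝ≥0∞) * ENNReal.ofReal (r ^ n)
          = K * ENNReal.ofReal (r ^ α) * ENNReal.ofReal (r ^ (n - α)) := by
            rw [mul_assoc, ← ENNReal.ofReal_mul (by positivity), ← Real.rpow_add hr]
            simp
        _ ≤ _ := by
            gcongr
            refine le_trans ?_ le_self_add
            gcongr
    · calc ∫⁻ y in cube a r, ‖f y‖ₑ ≤ fracMax γ f x * ENNReal.ofReal (r ^ (n - γ)) :=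
            setLIntegral_cube_le_fracMax hn γ f hr hxr
        _ = fracMax γ f x * ENNReal.ofReal (r ^ (α - γ)) * ENNReal.ofReal (r ^ (n - α)) := by
            rw [mul_assoc, ← ENNReal.ofReal_mul (by positivity), ← Real.rpow_add hr]
            congr 3
            ring
        _ ≤ _ := by
            gcongr ?_ * _
            refine le_trans ?_ le_add_self
            gcongr fracMax γ f x * ENNReal.ofReal ?_
            exact Real.rpow_le_rpow_of_nonpos hδ hrδ (sub_nonpos.2 hαγ)
  · finiteness

/-- Bound for the modulus of a difference with extended real values. -/
theorem abs_mul_sub_le {c : ℝ} (hc : 0 ≤ c) {u v D : ℝ≥0∞} (hu : D ≠ ⊤ → u ≠ ⊤)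
    (h₁ : ENNReal.ofReal c * u ≤ v + D) (h₂ : v ≤ ENNReal.ofReal c * u + D) :
    ((c : EReal) * (u : EReal) - (v : EReal)).abs ≤ D := by
  by_cases hD : D = ⊤
  · rw [hD]; exact le_top
  have hu := hu hD
  have hv : v ≠ ⊤ := ne_top_of_le_ne_top (by finiteness) h₂
  lift u to ℝ≥0 using hu
  lift v to ℝ≥0 using hv
  lift D to ℝ≥0 using hD
  lift c to ℝ≥0 using hc
  rw [ENNReal.ofReal_coe_nnreal] at h₁ h₂
  norm_cast at h₁ h₂
  have e : (((c : ℝ) : EReal) * ((u : ℝ≥0∞) : EReal) - ((v : ℝ≥0∞) : EReal)) =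
      (((c * u - v : ℝ)) : EReal) := by
    rw [EReal.coe_nnreal_eq_coe_real, EReal.coe_nnreal_eq_coe_real, EReal.coe_sub, EReal.coe_mul]
  rw [e, EReal.abs_def, ← ENNReal.ofReal_coe_nnreal]
  refine ENNReal.ofReal_le_ofReal (abs_le.2 ?_)
  have h₁' : (c : ℝ) * u ≤ v + D := by exact_mod_cast h₁
  have h₂' : (v : ℝ) ≤ c * u + D := by exact_mod_cast h₂
  constructor <;> linarith

/-- The oscillation of a Lipschitz function on a cube. -/
theorem enorm_sub_le_of_mem_cube {β C : ℝ} (hβ : 0 ≤ β) (hC : 0 ≤ C) {g : Rn n → ℝ}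
    (hg : ∀ x y : Rn n, |g x - g y| ≤ C * ‖x - y‖ ^ β) {a x y : Rn n} {r : ℝ} (hr : 0 ≤ r)
    (hx : x ∈ cube a r) (hy : y ∈ cube a r) :
    ‖g x - g y‖ₑ ≤ ENNReal.ofReal (C * √n ^ β) * ENNReal.ofReal (r ^ β) := by
  rw [Real.enorm_eq_ofReal_abs, ← ENNReal.ofReal_mul (by positivity), mul_assoc,
    ← Real.mul_rpow (by positivity) hr]
  refine ENNReal.ofReal_le_ofReal ((hg x y).trans ?_)
  gcongr
  exact norm_sub_le_of_mem_cube hr hx hy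

section Lipschitz

variable {β C : ℝ} {g f : Rn n → ℝ} {a x : Rn n} {r : ℝ}

theorem mul_setLIntegral_cube_le (hβ : 0 ≤ β) (hC : 0 ≤ C)
    (hg : ∀ x y : Rn n, |g x - g y| ≤ C * ‖x - y‖ ^ β) (hf : AEMeasurable f volume) (hr : 0 ≤ r)
    (hx : x ∈ cube a r) :
    ‖g x‖ₑ * ∫⁻ y in cube a r, ‖f y‖ₑ ≤ (∫⁻ y in cube a r, ‖g y * f y‖ₑ) +
      ENNReal.ofReal (C * √n ^ β) * ENNReal.ofReal (r ^ β) * ∫⁻ y in cube a r, ‖f y‖ₑ := by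
  rw [← lintegral_const_mul' _ _ enorm_ne_top, ← lintegral_const_mul' _ _ (by finiteness),
    ← lintegral_add_right' _ (hf.enorm.restrict.const_mul _)]
  refine setLIntegral_mono' (measurableSet_cube a r) fun y hy => ?_
  rw [enorm_mul, ← add_mul]
  gcongr
  calc ‖g x‖ₑ = ‖g y + (g x - g y)‖ₑ := by rw [add_sub_cancel]
    _ ≤ ‖g y‖ₑ + ‖g x - g y‖ₑ := enorm_add_le _ _
    _ ≤ _ := by gcongr; exact enorm_sub_le_of_mem_cube hβ hC hg hr hx hy

theorem setLIntegral_cube_mul_le (hβ : 0 ≤ β) (hC : 0 ≤ C)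
    (hg : ∀ x y : Rn n, |g x - g y| ≤ C * ‖x - y‖ ^ β) (hr : 0 ≤ r)
    (hx : x ∈ cube a r) :
    ∫⁻ y in cube a r, ‖g y * f y‖ₑ ≤ ‖g x‖ₑ * (∫⁻ y in cube a r, ‖f y‖ₑ) +
      ENNReal.ofReal (C * √n ^ β) * ENNReal.ofReal (r ^ β) * ∫⁻ y in cube a r, ‖f y‖ₑ := by
  rw [← add_mul, ← lintegral_const_mul' _ _ (by finiteness)]
  refine setLIntegral_mono' (measurableSet_cube a r) fun y hy => ?_
  rw [enorm_mul]
  gcongr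
  calc ‖g y‖ₑ = ‖g x + (g y - g x)‖ₑ := by rw [add_sub_cancel]
    _ ≤ ‖g x‖ₑ + ‖g y - g x‖ₑ := enorm_add_le _ _
    _ ≤ _ := by gcongr; exact enorm_sub_le_of_mem_cube hβ hC hg hr hy hx

end Lipschitz

/-- The commutator with a non-negative Lipschitz function is controlled by `M_{α + β}`. -/
theorem abs_commutator_le (hn : n ≠ 0) {α β C : ℝ} (hβ : 0 ≤ β) (hC : 0 ≤ C) {b g f : Rn n → ℝ}
    (hbg : b =ᵐ[volume] g) (hg : ∀ x y : Rn n, |g x - g y| ≤ C * ‖x - y‖ ^ β)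
    (hg0 : ∀ x, 0 ≤ g x) (hf : AEMeasurable f volume) {x : Rn n} (hx : b x = g x)
    {L : ℝ} (hL : 0 < L) (hCL : C * √n ^ β ≤ L)
    (hfin : fracMax (α + β) f x < ⊤ → fracMax α f x < ⊤) :
    (commutator α b f x).abs ≤ ENNReal.ofReal L * fracMax (α + β) f x := by
  have hL' : ENNReal.ofReal L ≠ 0 := by simpa using hL
  have hbf : fracMax α (fun y => b y * f y) = fracMax α (fun y => g y * f y) :=
    fracMax_congr_ae (hbg.mono fun y hy => by simp only [hy]) α
  have key : ∀ (a : Rn n) (r : ℝ), 0 < r → x ∈ cube a r →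
      ENNReal.ofReal (C * √n ^ β) * ENNReal.ofReal (r ^ β) * ∫⁻ y in cube a r, ‖f y‖ₑ ≤
      ENNReal.ofReal L * fracMax (α + β) f x * ENNReal.ofReal (r ^ (n - α)) := by
    intro a r hr hxr
    calc ENNReal.ofReal (C * √n ^ β) * ENNReal.ofReal (r ^ β) * ∫⁻ y in cube a r, ‖f y‖ₑ
        ≤ ENNReal.ofReal L * ENNReal.ofReal (r ^ β) *
          (fracMax (α + β) f x * ENNReal.ofReal (r ^ (n - (α + β)))) := by
          gcongr
          exact setLIntegral_cube_le_fracMax hn _ f hr hxr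
      _ = ENNReal.ofReal L * fracMax (α + β) f x *
          (ENNReal.ofReal (r ^ β) * ENNReal.ofReal (r ^ (n - (α + β)))) := by ring
      _ = _ := by
          rw [← ENNReal.ofReal_mul (by positivity), ← Real.rpow_add hr]
          congr 3
          ring
  rw [commutator, hbf, hx]
  have hgx : ENNReal.ofReal (g x) = ‖g x‖ₑ := (Real.enorm_eq_ofReal (hg0 x)).symm
  refine abs_mul_sub_le (hg0 x) (fun hD => ?_) ?_ ?_
  · refine (hfin (lt_top_iff_ne_top.2 fun h => hD ?_)).ne
    rw [h, ENNReal.mul_top hL']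
  · rw [hgx]
    by_cases hg0' : ‖g x‖ₑ = 0
    · rw [hg0', zero_mul]; exact zero_le
    rw [mul_comm, ← ENNReal.le_div_iff_mul_le (Or.inl hg0') (Or.inl enorm_ne_top)]
    refine (fracMax_le_iff hn).2 fun a r hr hxr => ?_
    rw [ENNReal.mul_comm_div, ← mul_div_assoc,
      ENNReal.le_div_iff_mul_le (Or.inl hg0') (Or.inl enorm_ne_top), mul_comm, add_mul]
    refine (mul_setLIntegral_cube_le hβ hC hg hf hr.le hxr).trans ?_
    gcongr ?_ + ?_
    · exact setLIntegral_cube_le_fracMax hn α _ hr hxr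
    · exact key a r hr hxr
  · rw [hgx]
    refine (fracMax_le_iff hn).2 fun a r hr hxr => ?_
    refine (setLIntegral_cube_mul_le hβ hC hg hr.le hxr).trans ?_
    rw [add_mul, mul_assoc ‖g x‖ₑ]
    gcongr ‖g x‖ₑ * ?_ + ?_
    · exact setLIntegral_cube_le_fracMax hn α _ hr hxr
    · exact key a r hr hxr

theorem commutatorBounded_of_lipschitz (hn : n ≠ 0) {α β : ℝ} (hβ : 0 < β) (hα : 0 < α)
    (hαβ : α + β < n) {b g : Rn n → ℝ} (hbg : b =ᵐ[volume] g) (hg : IsHomLipschitz β g)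
    (hg0 : ∀ x, 0 ≤ g x) {p q : Rn n → ℝ} (h : ExpPair (α + β) p q) :
    CommutatorBounded α b p q := by
  obtain ⟨C, hC, hg⟩ := hg
  obtain ⟨A, hA, hM⟩ := h.varNorm_fracMax_le hn (add_pos hα hβ) hαβ
  have hn' : (0 : ℝ) < √n := Real.sqrt_pos.2 (Nat.cast_pos.2 hn.bot_lt)
  have hL : 0 < C * √n ^ β := by positivity
  set L : ℝ≥0 := (C * √n ^ β).toNNReal with hLdef
  have hL0 : L ≠ 0 := (Real.toNNReal_pos.2 hL).ne'
  refine ⟨L * A, fun f hf => ?_⟩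
  calc varNorm q (fun x => (commutator α b f x).abs)
      ≤ varNorm q (fun x => L * fracMax (α + β) f x) := by
        refine varNorm_mono (fun x => (h.right_pos hαβ x).le) ?_
        filter_upwards [hbg, ae_fracMax_lt_top_of_le hn hα.le (le_add_of_nonneg_right hβ.le)
          (hf.locallyIntegrable h.one_le_left)] with x hx hfin
        exact abs_commutator_le hn hβ.le hC.le hbg hg hg0 hf.1 hx hL le_rfl hfin
    _ ≤ L * varNorm q (fracMax (α + β) f) := varNorm_const_mul_le hL0
    _ ≤ L * (A * varNorm p (fun x => ‖f x‖ₑ)) := by gcongr; exact hM f hf.1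
    _ = _ := by rw [ENNReal.coe_mul, mul_assoc]

theorem abs_sub_fracMaxOn_le (hn : n ≠ 0) {α β C : ℝ} (hα : 0 ≤ α) (hβ : 0 ≤ β) (hC : 0 ≤ C)
    {b g : Rn n → ℝ}
    (hbg : b =ᵐ[volume] g) (hg : ∀ x y : Rn n, |g x - g y| ≤ C * ‖x - y‖ ^ β)
    (hg0 : ∀ x, 0 ≤ g x) {a x : Rn n} {r : ℝ} (hr : 0 < r) (hxr : x ∈ cube a r)
    (hx : b x = g x) :
    ((b x : EReal) - ((volume (cube a r) ^ (-(α / (n : ℝ))) *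
      fracMaxOn α (cube a r) b x : ℝ≥0∞) : EReal)).abs ≤
      ENNReal.ofReal (C * √n ^ β) * volume (cube a r) ^ (β / (n : ℝ)) := by
  have hgx : ENNReal.ofReal (g x) = ‖g x‖ₑ := (Real.enorm_eq_ofReal (hg0 x)).symm
  have hone : ∀ (a' : Rn n) {r' : ℝ}, 0 ≤ r' → ∫⁻ _y in cube a' r', ‖(1 : ℝ)‖ₑ =
      ENNReal.ofReal (r' ^ n) := fun a' r' hr' => by simp [volume_cube a' hr']
  have h1 := abs_mul_sub_le (hg0 x) (u := 1)
    (v := volume (cube a r) ^ (-(α / (n : ℝ))) * fracMaxOn α (cube a r) b x)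
    (D := ENNReal.ofReal (C * √n ^ β) * volume (cube a r) ^ (β / (n : ℝ)))
    (fun _ => ENNReal.one_ne_top) ?_ ?_
  · rw [hx]
    simpa using h1
  · rw [fracMaxOn_congr_ae hbg, mul_one, hgx, volume_cube_rpow hn a hr, ← neg_div,
      volume_cube_rpow hn a hr]
    have h2 := mul_setLIntegral_cube_le (f := fun _ => 1) hβ hC hg aemeasurable_const hr.le hxr
    rw [hone a hr.le] at h2
    simp only [mul_one] at h2
    have h3 := setLIntegral_cube_le_fracMaxOn hn α g hr hxr subset_rfl
    have h4 : ENNReal.ofReal (r ^ n) ≠ 0 := by simpa using pow_pos hr n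
    rw [← ENNReal.mul_le_mul_iff_left h4 ENNReal.ofReal_ne_top, add_mul]
    refine h2.trans ?_
    gcongr ?_ + _
    refine h3.trans_eq ?_
    rw [mul_comm (ENNReal.ofReal (r ^ (-α))), mul_assoc, ← ENNReal.ofReal_mul (by positivity),
      ← Real.rpow_natCast r n, ← Real.rpow_add hr]
    congr 3
    ring
  · rw [fracMaxOn_congr_ae hbg, mul_one, hgx, volume_cube_rpow hn a hr, ← neg_div,
      volume_cube_rpow hn a hr]
    have h4 : ENNReal.ofReal (r ^ (-α)) ≠ 0 := ofReal_rpow_ne_zero hr _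
    rw [mul_comm, ← ENNReal.le_div_iff_mul_le (Or.inl h4) (Or.inl ENNReal.ofReal_ne_top)]
    refine (fracMaxOn_le_iff hn).2 fun a' r' hr' hxr' hsub => ?_
    have hrr : r' ≤ r := by
      have := measure_mono (μ := volume) hsub
      rw [volume_cube _ hr.le, volume_cube _ hr'.le,
        ENNReal.ofReal_le_ofReal_iff (by positivity)] at this
      exact (pow_le_pow_iff_left₀ hr'.le hr.le hn).1 this
    have h2 := setLIntegral_cube_mul_le (f := fun _ => 1) hβ hC hg hr'.le hxr'
    rw [hone a' hr'.le] at h2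
    simp only [mul_one] at h2
    refine h2.trans ?_
    have h5 : ENNReal.ofReal (r' ^ n) =
        ENNReal.ofReal (r' ^ α) * ENNReal.ofReal (r' ^ (n - α)) := by
      rw [← ENNReal.ofReal_mul (by positivity), ← Real.rpow_add hr']
      simp
    have h6 : ENNReal.ofReal (r' ^ α) * ENNReal.ofReal (r ^ (-α)) ≤ 1 := by
      rw [← ENNReal.ofReal_mul (by positivity), ENNReal.ofReal_le_one, Real.rpow_neg hr.le,
        mul_inv_le_iff₀ (by positivity), one_mul]
      gcongr
    rw [← add_mul, h5, ← mul_assoc]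
    gcongr
    rw [ENNReal.le_div_iff_mul_le (Or.inl h4) (Or.inl ENNReal.ofReal_ne_top), mul_assoc]
    refine (mul_le_of_le_one_right' h6).trans ?_
    gcongr

theorem oscillationFinite_of_lipschitz (hn : n ≠ 0) {α β : ℝ} (hβ : 0 ≤ β) (hα : 0 ≤ α)
    {b g : Rn n → ℝ} (hbg : b =ᵐ[volume] g) (hg : IsHomLipschitz β g)
    (hg0 : ∀ x, 0 ≤ g x) {s : Rn n → ℝ} (hs : ∀ x, 1 ≤ s x) :
    OscillationFinite α β b s := by
  obtain ⟨C, hC, hg⟩ := hg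
  have hn' : (0 : ℝ) < √n := Real.sqrt_pos.2 (Nat.cast_pos.2 hn.bot_lt)
  have hL : 0 < C * √n ^ β := by positivity
  refine lt_of_le_of_lt (iSup_le fun Q => iSup_le fun hQ => ?_)
    (ENNReal.ofReal_lt_top (r := C * √n ^ β))
  obtain ⟨a, r, hr, rfl⟩ := hQ
  rw [← cube]
  have hv0 : volume (cube a r) ^ (β / (n : ℝ)) ≠ 0 := by
    rw [volume_cube_rpow hn a hr]; exact ofReal_rpow_ne_zero hr _
  have hvt : volume (cube a r) ^ (β / (n : ℝ)) ≠ ⊤ := by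
    rw [volume_cube_rpow hn a hr]; exact ENNReal.ofReal_ne_top
  set c : ℝ≥0 := (ENNReal.ofReal (C * √n ^ β) * volume (cube a r) ^ (β / (n : ℝ))).toNNReal
  have hc : (c : ℝ≥0∞) = ENNReal.ofReal (C * √n ^ β) * volume (cube a r) ^ (β / (n : ℝ)) :=
    ENNReal.coe_toNNReal (ENNReal.mul_ne_top ENNReal.ofReal_ne_top hvt)
  have hc0 : c ≠ 0 := by
    rw [← ENNReal.coe_ne_zero, hc]
    exact mul_ne_zero (by simpa using hL) hv0
  have key : varNorm s ((cube a r).indicator fun x => ((b x : EReal) -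
      ((volume (cube a r) ^ (-(α / (n : ℝ))) * fracMaxOn α (cube a r) b x : ℝ≥0∞) : EReal)).abs) ≤
      c * varNorm s ((cube a r).indicator fun _ => 1) := by
    refine le_trans (varNorm_mono (fun x => zero_le_one.trans (hs x)) ?_)
      (varNorm_const_mul_le hc0)
    filter_upwards [hbg] with x hx
    by_cases hxr : x ∈ cube a r
    · simp only [Set.indicator_of_mem hxr, mul_one, hc]
      exact abs_sub_fracMaxOn_le hn hα hβ hC.le hbg hg hg0 hr hxr hx
    · simp [hxr]
  rw [one_div, mul_comm, ← div_eq_mul_inv, ENNReal.div_le_iff hv0 hvt, ← hc]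
  exact ENNReal.div_le_of_le_mul key

end Pointwise

/-! ### Campanato's characterization of Hölder functions -/

section Campanato

variable {n : ℕ}

theorem abs_setAverage_sub_le {b : Rn n → ℝ} (hb : LocallyIntegrable b volume) {x y : Rn n}
    {c M ρ R : ℝ} (hρ : 0 < ρ) (hR : 0 < R)
    (hsub : Metric.closedBall y ρ ⊆ Metric.closedBall x R)
    (hc : ∫ z in Metric.closedBall x R, |b z - c| ≤ M * volume.real (Metric.closedBall x R)) :
    |(⨍ z in Metric.closedBall y ρ, b z) - c| ≤ (R / ρ) ^ n * M := by
  have hint : ∀ (w : Rn n) (r : ℝ), IntegrableOn (fun z => b z - c) (Metric.closedBall w r) :=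
    fun w r => (hb.integrableOn_isCompact (isCompact_closedBall _ _)).sub
      (integrableOn_const Metric.isBounded_closedBall.measure_lt_top.ne)
  have hvol : ∀ (w : Rn n) {r : ℝ}, 0 < r → volume.real (Metric.closedBall w r) =
      r ^ n * volume.real (Metric.ball (0 : Rn n) 1) := fun w r hr => by
    rw [Measure.addHaar_real_closedBall _ _ hr.le, finrank_euclideanSpace_fin]
  have hv : 0 < volume.real (Metric.closedBall y ρ) :=
    ENNReal.toReal_pos (Metric.measure_closedBall_pos _ y hρ).ne'
      Metric.isBounded_closedBall.measure_lt_top.ne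
  have h1 : volume.real (Metric.closedBall y ρ) * ((⨍ z in Metric.closedBall y ρ, b z) - c) =
      ∫ z in Metric.closedBall y ρ, (b z - c) := by
    rw [integral_sub (hb.integrableOn_isCompact (isCompact_closedBall _ _))
      (integrableOn_const Metric.isBounded_closedBall.measure_lt_top.ne), setIntegral_const,
      setAverage_eq, smul_eq_mul, smul_eq_mul, mul_sub, mul_inv_cancel_left₀ hv.ne']
  have h2 : volume.real (Metric.closedBall y ρ) * |(⨍ z in Metric.closedBall y ρ, b z) - c| ≤
      M * volume.real (Metric.closedBall x R) := by
    have h3 := abs_mul (volume.real (Metric.closedBall y ρ)) ((⨍ z in Metric.closedBall y ρ, b z) - c)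
    rw [abs_of_pos hv, h1] at h3
    rw [← h3]
    refine (abs_integral_le_integral_abs).trans (le_trans ?_ hc)
    exact setIntegral_mono_set (hint x R).abs (Filter.Eventually.of_forall fun z => abs_nonneg _)
      hsub.eventuallyLE
  rw [← le_div_iff₀' hv] at h2
  refine h2.trans_eq ?_
  rw [hvol x hR, hvol y hρ, div_pow]
  have hv1 : volume.real (Metric.ball (0 : Rn n) 1) ≠ 0 := fun h => by
    rw [hvol y hρ, h, mul_zero] at hv
    exact hv.false
  field_simp

theorem exists_ae_holder_of_oscillation {β K : ℝ} (hβ : 0 < β) (hK : 0 ≤ K)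
    {b : Rn n → ℝ} (hb : LocallyIntegrable b volume)
    (h : ∀ (x : Rn n) (R : ℝ), 0 < R → ∃ c, ∫ z in Metric.closedBall x R, |b z - c| ≤
      K * R ^ β * volume.real (Metric.closedBall x R)) :
    ∃ L : ℝ, 0 < L ∧ ∃ A : Set (Rn n), (∀ᵐ x, x ∈ A) ∧
      ∀ x ∈ A, ∀ y ∈ A, |b x - b y| ≤ L * ‖x - y‖ ^ β := by
  set m : Rn n → ℝ → ℝ := fun x R => ⨍ z in Metric.closedBall x R, b z with hm
  set θ : ℝ := (1 / 2) ^ β with hθ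
  have hθ0 : 0 ≤ θ := by positivity
  have hθ1 : θ < 1 := Real.rpow_lt_one (by norm_num) (by norm_num) hβ
  have hθ1' : 0 < 1 - θ := sub_pos.2 hθ1
  set D : ℝ := (1 + 2 ^ n) * K with hD
  have hD0 : 0 ≤ D := by positivity
  set A : Set (Rn n) := {x | ∀ R > 0, |m x R - b x| ≤ D * R ^ β / (1 - θ)} with hA
  refine ⟨2 * (D / (1 - θ)) + 2 * (2 ^ n * (K * 2 ^ β)) + 1, by positivity, A, ?_, ?_⟩
  · filter_upwards [IsUnifLocDoublingMeasure.ae_tendsto_average volume hb 0] with x hx R hR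
    have hpos : ∀ k : ℕ, 0 < R * (1 / 2) ^ k := fun k => by positivity
    have hlim : Filter.Tendsto (fun k : ℕ => m x (R * (1 / 2) ^ k)) Filter.atTop (nhds (b x)) := by
      refine hx (fun _ => x) (fun k : ℕ => R * (1 / 2) ^ k) ?_
        (Filter.Eventually.of_forall fun k => by simp)
      refine tendsto_nhdsWithin_iff.2 ⟨?_, Filter.Eventually.of_forall hpos⟩
      simpa using (tendsto_pow_atTop_nhds_zero_of_lt_one (r := (1 / 2 : ℝ)) (by norm_num)
        (by norm_num)).const_mul R
    have hstep : ∀ k : ℕ, dist (m x (R * (1 / 2) ^ k)) (m x (R * (1 / 2) ^ (k + 1))) ≤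
        D * R ^ β * θ ^ k := fun k => by
      obtain ⟨c, hc⟩ := h x _ (hpos k)
      have h1 := abs_setAverage_sub_le hb (hpos k) (hpos k) subset_rfl hc
      have h2 := abs_setAverage_sub_le hb (hpos (k + 1)) (hpos k)
        (Metric.closedBall_subset_closedBall (by
          rw [pow_succ, ← mul_assoc]
          linarith [hpos k])) hc
      have h3 : R * (1 / 2) ^ k / (R * (1 / 2) ^ (k + 1)) = 2 := by
        rw [pow_succ]; field_simp
      rw [div_self (hpos k).ne', one_pow, one_mul] at h1
      rw [h3] at h2
      have h4 : K * (R * (1 / 2) ^ k) ^ β = K * (R ^ β * θ ^ k) := by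
        rw [Real.mul_rpow hR.le (by positivity), hθ, ← Real.rpow_natCast, ← Real.rpow_natCast,
          ← Real.rpow_mul (by norm_num), ← Real.rpow_mul (by norm_num), mul_comm β]
      rw [h4] at h1 h2
      rw [Real.dist_eq]
      calc _ ≤ _ := abs_sub_le _ c _
        _ ≤ K * (R ^ β * θ ^ k) + 2 ^ n * (K * (R ^ β * θ ^ k)) := by
          rw [abs_sub_comm c]
          exact add_le_add h1 h2
        _ = _ := by rw [hD]; ring
    have h5 := dist_le_of_le_geometric_of_tendsto₀ θ (D * R ^ β) hθ1 hstep hlim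
    rwa [pow_zero, mul_one, Real.dist_eq] at h5
  · intro x hx y hy
    rcases eq_or_ne x y with rfl | hxy
    · simp only [sub_self, abs_zero, norm_zero]
      positivity
    have hR : 0 < ‖x - y‖ := norm_pos_iff.2 (sub_ne_zero.2 hxy)
    set R := ‖x - y‖
    have h2R : 0 < 2 * R := by positivity
    obtain ⟨c, hc⟩ := h x (2 * R) h2R
    have h1 := abs_setAverage_sub_le hb hR h2R
      (Metric.closedBall_subset_closedBall (by linarith)) hc
    have h2 := abs_setAverage_sub_le hb (y := y) hR h2R
      (Metric.closedBall_subset_closedBall' (by rw [dist_comm, dist_eq_norm]; linarith)) hc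
    rw [mul_div_cancel_right₀ _ hR.ne', Real.mul_rpow zero_le_two hR.le] at h1 h2
    have h3 := hx R hR
    have h4 := hy R hR
    have h5 : 0 ≤ R ^ β := by positivity
    have e1 : D * R ^ β / (1 - θ) = D / (1 - θ) * R ^ β := by ring
    rw [e1] at h3 h4
    change |m x R - c| ≤ _ at h1
    change |m y R - c| ≤ _ at h2
    rw [abs_le] at *
    constructor <;> nlinarith

/-- McShane's extension of a non-negative Hölder function. -/
theorem exists_holder_extension {β L : ℝ} (hβ₀ : 0 < β) (hβ₁ : β ≤ 1) (hL : 0 < L) {b : Rn n → ℝ}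
    {A : Set (Rn n)} (hA : A.Nonempty) (hb0 : ∀ x ∈ A, 0 ≤ b x)
    (hb : ∀ x ∈ A, ∀ y ∈ A, |b x - b y| ≤ L * ‖x - y‖ ^ β) :
    ∃ g : Rn n → ℝ, (∀ x ∈ A, b x = g x) ∧ IsHomLipschitz β g ∧ ∀ x, 0 ≤ g x := by
  have := hA.to_subtype
  have h0 : ∀ (x : Rn n) (y : A), 0 ≤ b y + L * ‖x - y‖ ^ β := fun x y =>
    add_nonneg (hb0 y y.2) (by positivity)
  have hbdd : ∀ x : Rn n, BddBelow (Set.range fun y : A => b y + L * ‖x - y‖ ^ β) := fun x =>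
    ⟨0, Set.forall_mem_range.2 (h0 x)⟩
  have hle : ∀ x y : Rn n, (⨅ z : A, (b z + L * ‖x - z‖ ^ β)) ≤
      (⨅ z : A, (b z + L * ‖y - z‖ ^ β)) + L * ‖x - y‖ ^ β := fun x y => by
    rw [← sub_le_iff_le_add]
    refine le_ciInf fun z => ?_
    rw [sub_le_iff_le_add]
    refine (ciInf_le (hbdd x) z).trans ?_
    have h1 : ‖x - z‖ ^ β ≤ ‖x - y‖ ^ β + ‖y - z‖ ^ β :=
      (Real.rpow_le_rpow (norm_nonneg _) (norm_sub_le_norm_sub_add_norm_sub x y z) hβ₀.le).trans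
        (Real.rpow_add_le_add_rpow (norm_nonneg _) (norm_nonneg _) hβ₀.le hβ₁)
    nlinarith
  refine ⟨fun x => ⨅ z : A, (b z + L * ‖x - z‖ ^ β), fun x hx => le_antisymm ?_ ?_,
    ⟨L, hL, fun x y => ?_⟩, fun x => le_ciInf (h0 x)⟩
  · refine le_ciInf fun z => ?_
    have := (abs_le.1 (hb x hx z z.2)).2
    linarith
  · refine (ciInf_le (hbdd x) ⟨x, hx⟩).trans_eq ?_
    simp [Real.zero_rpow hβ₀.ne']
  · have h1 := hle x y
    have h2 := hle y x
    rw [norm_sub_rev y x] at h2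
    rw [abs_le]
    constructor <;> linarith

end Campanato

/-! ### Averages over cubes in variable Lebesgue spaces -/

section Average

variable {n : ℕ}

/-- The averaging operators over cubes are uniformly bounded on `L^{s(·)}`. -/
def HasAverageBound (s : Rn n → ℝ) (C : ℝ≥0) : Prop :=
  ∀ Q : Set (Rn n), IsCube Q → ∀ f : Rn n → ℝ, AEMeasurable f volume →
    (∫⁻ y in Q, ‖f y‖ₑ) / volume Q * varNorm s (Q.indicator fun _ => 1) ≤
      C * varNorm s (Q.indicator fun y => ‖f y‖ₑ)

theorem mul_varNorm_le {p : Rn n → ℝ} {g : Rn n → ℝ≥0∞} {c : ℝ≥0} (hc : c ≠ 0) :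
    c * varNorm p g ≤ varNorm p (fun x => c * g x) := by
  have hc' : (c : ℝ≥0∞) ≠ 0 := by simpa using hc
  have h := varNorm_const_mul_le (p := p) (g := fun x => c * g x) (inv_ne_zero hc)
  have e : (fun x => ((c⁻¹ : ℝ≥0) : ℝ≥0∞) * (c * g x)) = g := by
    funext x
    rw [ENNReal.coe_inv hc, ENNReal.inv_mul_cancel_left' (by simp [hc]) (by simp)]
  rw [e] at h
  calc (c : ℝ≥0∞) * varNorm p g ≤ c * (((c⁻¹ : ℝ≥0) : ℝ≥0∞) * varNorm p (fun x => c * g x)) := by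
        gcongr
    _ = _ := by
        rw [ENNReal.coe_inv hc, ENNReal.mul_inv_cancel_left hc' ENNReal.coe_ne_top]

theorem memVarLp_of_varNorm_ne_top {p : Rn n → ℝ} {f : Rn n → ℝ} (hf : AEMeasurable f volume)
    (h : varNorm p (fun x => ‖f x‖ₑ) ≠ ⊤) : MemVarLp p f := by
  obtain ⟨t, ht, -, hm⟩ := exists_modular_le_of_varNorm_lt (lt_top_iff_ne_top.2 h)
  exact ⟨hf, t, ht, hm.trans_lt ENNReal.one_lt_top⟩

theorem enorm_indicator_eq (Q : Set (Rn n)) (f : Rn n → ℝ) :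
    (fun x => ‖Q.indicator f x‖ₑ) = Q.indicator fun x => ‖f x‖ₑ :=
  funext fun x => enorm_indicator_eq_indicator_enorm f x

theorem ExpB.hasAverageBound {s : Rn n → ℝ} (hs : ExpB s) : ∃ C : ℝ≥0, HasAverageBound s C := by
  obtain ⟨⟨hsm, hs1, -⟩, C, hC⟩ := hs
  refine ⟨C + 1, fun Q hQ f hf => ?_⟩
  by_cases htop : varNorm s (Q.indicator fun y => ‖f y‖ₑ) = ⊤
  · rw [htop, ENNReal.mul_top (by simp)]
    exact le_top
  have hfQ : AEMeasurable (Q.indicator f) volume := hf.indicator hQ.measurableSet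
  have hmem : MemVarLp s (Q.indicator f) :=
    memVarLp_of_varNorm_ne_top hfQ (by rwa [enorm_indicator_eq])
  have hint : ∫⁻ y in Q, ‖Q.indicator f y‖ₑ = ∫⁻ y in Q, ‖f y‖ₑ :=
    setLIntegral_congr_fun hQ.measurableSet fun y hy => by
      simp only [Set.indicator_of_mem hy]
  set m : ℝ≥0 := ((∫⁻ y in Q, ‖f y‖ₑ) / volume Q).toNNReal
  have hm : (m : ℝ≥0∞) = (∫⁻ y in Q, ‖f y‖ₑ) / volume Q := by
    refine ENNReal.coe_toNNReal (ENNReal.div_ne_top ?_ hQ.volume_ne_zero)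
    rw [← hint]
    exact hQ.lintegral_enorm_ne_top (hmem.locallyIntegrable hs1)
  rw [← hm]
  rcases eq_or_ne m 0 with h0 | h0
  · simp [h0]
  calc (m : ℝ≥0∞) * varNorm s (Q.indicator fun _ => 1)
      ≤ varNorm s (fun x => m * Q.indicator (fun _ => 1) x) := mul_varNorm_le h0
    _ ≤ varNorm s (fracMax 0 (Q.indicator f)) := by
        refine varNorm_mono (fun x => zero_le_one.trans (hs1 x))
          (Filter.Eventually.of_forall fun x => ?_)
        by_cases hx : x ∈ Q
        · rw [Set.indicator_of_mem hx, mul_one, hm, ← hint]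
          refine le_iSup_of_le Q (le_iSup_of_le hQ (le_iSup_of_le hx ?_))
          rw [zero_div, sub_zero, ENNReal.rpow_one]
        · simp [hx]
    _ ≤ C * varNorm s (fun x => ‖Q.indicator f x‖ₑ) := hC _ hmem
    _ ≤ ((C + 1 : ℝ≥0) : ℝ≥0∞) * varNorm s (Q.indicator fun y => ‖f y‖ₑ) := by
        rw [enorm_indicator_eq]
        gcongr
        exact le_self_add

theorem setLIntegral_div_volume_rpow_le {Q : Set (Rn n)} (hQ : IsCube Q) {r : ℝ} (hr : 1 ≤ r)
    {F : Rn n → ℝ≥0∞} (hF : AEMeasurable F volume) :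
    ((∫⁻ y in Q, F y) / volume Q) ^ r ≤ (∫⁻ y in Q, F y ^ r) / volume Q := by
  have hr0 : 0 < r := zero_lt_one.trans_le hr
  have hri : r⁻¹ ≤ 1 := inv_le_one_of_one_le₀ hr
  have h1 : ∫⁻ y in Q, F y ≤ (∫⁻ y in Q, F y ^ r) ^ r⁻¹ * volume Q ^ (1 - r⁻¹) := by
    have := ENNReal.lintegral_mul_norm_pow_le (μ := volume.restrict Q) (f := fun y => F y ^ r)
      (g := fun _ => 1) (hF.restrict.pow_const r) aemeasurable_const
      (p := r⁻¹) (q := 1 - r⁻¹) (by positivity) (sub_nonneg.2 hri) (by ring)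
    simpa [← ENNReal.rpow_mul, hr0.ne'] using this
  rw [← ENNReal.le_rpow_inv_iff hr0, ENNReal.div_rpow_of_nonneg _ _ (inv_nonneg.2 hr0.le),
    ENNReal.div_le_iff hQ.volume_ne_zero hQ.volume_ne_top]
  refine h1.trans_eq ?_
  rw [ENNReal.rpow_sub _ _ hQ.volume_ne_zero hQ.volume_ne_top, ENNReal.rpow_one,
    ← mul_div_assoc, ENNReal.mul_comm_div, mul_div_assoc]

theorem varNorm_mul_rpow_le {s : Rn n → ℝ} (hs : ∀ x, 0 < s x) {r : ℝ} (hr : 0 < r) {Q : Set (Rn n)}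
    (hQ : IsCube Q) :
    varNorm (fun x => r * s x) (Q.indicator fun _ => 1) ^ r ≤
      varNorm s (Q.indicator fun _ => 1) := by
  refine le_iInf fun t => le_iInf fun ht => le_iInf fun hm => ?_
  rw [← ENNReal.le_rpow_inv_iff hr, ← ENNReal.coe_rpow_of_nonneg _ (inv_nonneg.2 hr.le)]
  refine varNorm_le (NNReal.rpow_pos ht) ?_
  rw [modular_indicator hQ.measurableSet hs] at hm
  rw [modular_indicator hQ.measurableSet (fun x => mul_pos hr (hs x))]
  refine le_of_eq_of_le (lintegral_congr fun x => ?_) hm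
  rw [ENNReal.rpow_mul, ENNReal.div_rpow_of_nonneg _ _ hr.le, ENNReal.one_rpow,
    ENNReal.coe_rpow_of_nonneg _ (inv_nonneg.2 hr.le), ENNReal.rpow_inv_rpow hr.ne']

theorem HasAverageBound.mul {s : Rn n → ℝ} {C : ℝ≥0} (h : HasAverageBound s C)
    (hs : ∀ x, 0 < s x) {r : ℝ} (hr : 1 ≤ r) :
    ∃ C' : ℝ≥0, HasAverageBound (fun x => r * s x) C' := by
  have hr0 : 0 < r := zero_lt_one.trans_le hr
  refine ⟨(C + 1) ^ r⁻¹, fun Q hQ f hf => le_mul_varNorm (by positivity) fun t ht hm => ?_⟩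
  have htt : (t : ℝ≥0∞) ≠ 0 := by simpa using ht.ne'
  have hg : ∀ y, ‖(|f y| / t) ^ r‖ₑ = (‖f y‖ₑ / t) ^ r := fun y => by
    have h0 : 0 ≤ |f y| / t := by positivity
    rw [Real.enorm_eq_ofReal (Real.rpow_nonneg h0 _), ← ENNReal.ofReal_rpow_of_nonneg h0 hr0.le,
      ENNReal.ofReal_div_of_pos (NNReal.coe_pos.2 ht), ENNReal.ofReal_coe_nnreal,
      ← Real.enorm_eq_ofReal_abs]
  have hgm : AEMeasurable (fun y => (|f y| / t) ^ r) volume :=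
    ((measurable_norm.comp_aemeasurable hf).div_const _).pow_const r
  have h1 := h Q hQ _ hgm
  simp only [hg] at h1
  have h2 : varNorm s (Q.indicator fun y => (‖f y‖ₑ / t) ^ r) ≤ 1 := by
    refine varNorm_le one_pos ?_
    rw [modular_indicator hQ.measurableSet (fun x => mul_pos hr0 (hs x))] at hm
    rw [modular_indicator hQ.measurableSet hs]
    refine le_of_eq_of_le (lintegral_congr fun x => ?_) hm
    rw [ENNReal.coe_one, div_one, ENNReal.rpow_mul]
  have h3 := setLIntegral_div_volume_rpow_le hQ hr (hf.enorm.div_const (t : ℝ≥0∞))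
  have h4 : ∫⁻ y in Q, ‖f y‖ₑ = t * ∫⁻ y in Q, ‖f y‖ₑ / t := by
    rw [← lintegral_const_mul' _ _ ENNReal.coe_ne_top]
    refine lintegral_congr fun y => ?_
    rw [ENNReal.mul_div_cancel htt ENNReal.coe_ne_top]
  rw [h4, mul_div_assoc, mul_assoc, mul_comm]
  gcongr
  rw [ENNReal.coe_rpow_of_nonneg _ (inv_nonneg.2 hr0.le), ENNReal.le_rpow_inv_iff hr0,
    ENNReal.mul_rpow_of_nonneg _ _ hr0.le]
  calc _ ≤ (∫⁻ y in Q, (‖f y‖ₑ / t) ^ r) / volume Q * varNorm s (Q.indicator fun _ => 1) :=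
        mul_le_mul' h3 (varNorm_mul_rpow_le hs hr0 hQ)
    _ ≤ C * 1 := h1.trans (by gcongr)
    _ ≤ _ := by
        rw [mul_one]
        exact_mod_cast le_self_add

theorem rpow_mul_rpow_le_add (a b : ℝ≥0∞) {v w : ℝ} (hv : 0 ≤ v) (hw : 0 ≤ w) (h : v + w = 1) :
    a ^ v * b ^ w ≤ a + b :=
  calc a ^ v * b ^ w ≤ (a + b) ^ v * (a + b) ^ w := by
        gcongr
        · exact le_self_add
        · exact le_add_self
    _ = a + b := by rw [← ENNReal.rpow_add_of_nonneg _ _ hv hw, h, ENNReal.rpow_one]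

/-- The norms of the characteristic function of a cube for an admissible pair. -/
theorem ExpPair.varNorm_indicator_le (hn : n ≠ 0) {γ : ℝ} (hγ₀ : 0 < γ) (hγn : γ < n)
    {p q : Rn n → ℝ} (h : ExpPair γ p q) (a : Rn n) {r : ℝ} (hr : 0 < r) :
    varNorm p ((cube a r).indicator fun _ => 1) ≤
      2 * ENNReal.ofReal (r ^ γ) * varNorm q ((cube a r).indicator fun _ => 1) := by
  have hn' : (0 : ℝ) < n := Nat.cast_pos.2 hn.bot_lt
  have hQ := isCube_cube a hr
  have hp1 := h.one_le_left
  have hp0 : ∀ x, 0 < p x := fun x => zero_lt_one.trans_le (hp1 x)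
  have hq0 := h.right_pos hγn
  set V : ℝ≥0 := (r ^ γ).toNNReal with hV
  have hV0 : 0 < V := Real.toNNReal_pos.2 (Real.rpow_pos_of_pos hr γ)
  have hVt : (V : ℝ≥0∞) ≠ 0 := by simpa using hV0.ne'
  have hvol : volume (cube a r) = (V : ℝ≥0∞) ^ (n / γ) := by
    rw [volume_cube a hr.le, hV]
    change _ = ENNReal.ofReal (r ^ γ) ^ (n / γ)
    rw [ENNReal.ofReal_rpow_of_pos (Real.rpow_pos_of_pos hr γ), ← Real.rpow_mul hr.le,
      mul_div_cancel₀ _ hγ₀.ne', Real.rpow_natCast]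
  change _ ≤ 2 * (V : ℝ≥0∞) * _
  have e2 : (2 * (V : ℝ≥0∞)) = ((2 * V : ℝ≥0) : ℝ≥0∞) := by simp
  rw [e2]
  refine le_mul_varNorm (by positivity) fun t ht hm => ?_
  have htt : (t : ℝ≥0∞) ≠ 0 := by simpa using ht.ne'
  rw [← ENNReal.coe_mul]
  refine varNorm_le (by positivity) ?_
  rw [modular_indicator hQ.measurableSet hq0] at hm
  rw [modular_indicator hQ.measurableSet hp0]
  calc ∫⁻ x in cube a r, ((1 : ℝ≥0∞) / ((2 * V * t : ℝ≥0) : ℝ≥0∞)) ^ p x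
      ≤ ∫⁻ x in cube a r, 2⁻¹ * ((1 / (t : ℝ≥0∞)) ^ q x + ((V : ℝ≥0∞)⁻¹) ^ (n / γ)) := by
        refine lintegral_mono fun x => ?_
        have e : (1 : ℝ≥0∞) / ((2 * V * t : ℝ≥0) : ℝ≥0∞) = 2⁻¹ * (1 / (t : ℝ≥0∞) * (V : ℝ≥0∞)⁻¹) := by
          rw [ENNReal.coe_mul, ENNReal.coe_mul, one_div, one_div,
            ENNReal.mul_inv (Or.inr ENNReal.coe_ne_top) (Or.inr htt),
            ENNReal.mul_inv (Or.inl (by simp)) (Or.inl (by simp))]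
          rw [ENNReal.coe_ofNat]
          ring
        have h1 : p x / q x + p x * (γ / n) = 1 := by rw [add_comm]; exact h.mul_add_div hγn x
        have h2 := rpow_mul_rpow_le_add ((1 / (t : ℝ≥0∞)) ^ q x) (((V : ℝ≥0∞)⁻¹) ^ (n / γ))
          (div_pos (hp0 x) (hq0 x)).le (by have := hp0 x; positivity) h1
        rw [← ENNReal.rpow_mul, ← ENNReal.rpow_mul, mul_div_cancel₀ _ (hq0 x).ne',
          show n / γ * (p x * (γ / n)) = p x by field_simp] at h2
        simp only [e]
        rw [ENNReal.mul_rpow_of_nonneg _ _ (hp0 x).le, ENNReal.mul_rpow_of_nonneg _ _ (hp0 x).le]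
        gcongr
        refine (ENNReal.rpow_le_rpow_of_exponent_ge ?_ (hp1 x)).trans_eq (ENNReal.rpow_one _)
        exact ENNReal.inv_le_one.2 one_le_two
    _ = 2⁻¹ * ((∫⁻ x in cube a r, (1 / (t : ℝ≥0∞)) ^ q x) +
          ((V : ℝ≥0∞)⁻¹) ^ (n / γ) * volume (cube a r)) := by
        rw [lintegral_const_mul' _ _ (by simp), lintegral_add_right _ measurable_const,
          setLIntegral_const]
    _ ≤ 2⁻¹ * (1 + 1) := by
        gcongr
        rw [hvol, ← ENNReal.mul_rpow_of_nonneg _ _ (by positivity),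
          ENNReal.inv_mul_cancel hVt ENNReal.coe_ne_top, ENNReal.one_rpow]
    _ = 1 := by
        rw [one_add_one_eq_two, ENNReal.inv_mul_cancel (by simp) (by simp)]

end Average

/-! ### Regularity from the one-sided oscillation -/

section Regularity

variable {n : ℕ}

/-- The one-sided oscillation `(|b|_Q - b)⁺` controls `b` in the Lipschitz class and forces
`b ≥ 0`. -/
theorem exists_lipschitz_of_setLIntegral_le {β : ℝ} (hβ₀ : 0 < β) (hβ₁ : β ≤ 1)
    {b : Rn n → ℝ} (hb : LocallyIntegrable b volume) {E : ℝ≥0}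
    (hE : ∀ (a : Rn n) (r : ℝ), 0 < r →
      ∫⁻ x in cube a r, ENNReal.ofReal ((⨍ y in cube a r, |b y|) - b x) ≤
        E * ENNReal.ofReal (r ^ β) * volume (cube a r)) :
    ∃ g : Rn n → ℝ, b =ᵐ[volume] g ∧ IsHomLipschitz β g ∧ ∀ x, 0 ≤ g x := by
  set v := volume.real (Metric.ball (0 : Rn n) 1) with hv
  have hv0 : 0 < v := ENNReal.toReal_pos (volume_ball_ne_zero _ one_pos)
    Metric.isBounded_ball.measure_lt_top.ne
  have hbQ : ∀ (a : Rn n) (r : ℝ), 0 < r → IntegrableOn b (cube a r) := fun a r hr =>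
    (hb.integrableOn_isCompact (isCube_cube a hr).isBounded.isCompact_closure).mono_set
      subset_closure
  have hcQ : ∀ (a : Rn n) (r : ℝ) (c : ℝ), 0 < r → IntegrableOn (fun _ : Rn n => c) (cube a r) :=
    fun a r c hr => integrableOn_const (isCube_cube a hr).volume_ne_top
  have hposint : ∀ (a : Rn n) (r : ℝ), 0 < r →
      ∫ x in cube a r, max ((⨍ y in cube a r, |b y|) - b x) 0 ≤ E * r ^ β * r ^ n := by
    intro a r hr
    have h1 : IntegrableOn (fun x => max ((⨍ y in cube a r, |b y|) - b x) 0) (cube a r) :=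
      ((hcQ a r _ hr).sub (hbQ a r hr)).pos_part
    have h0 : 0 ≤ E * r ^ β * r ^ n := by positivity
    refine (ENNReal.ofReal_le_ofReal_iff h0).1 ?_
    rw [ofReal_integral_eq_lintegral_ofReal h1
      (Filter.Eventually.of_forall fun x => le_max_right _ _)]
    have hmax : ∀ t : ℝ, ENNReal.ofReal (max t 0) = ENNReal.ofReal t := fun t => by simp
    simp only [hmax]
    refine (hE a r hr).trans_eq ?_
    rw [volume_cube a hr.le, ENNReal.ofReal_mul (by positivity), ENNReal.ofReal_mul (by positivity),
      ENNReal.ofReal_coe_nnreal]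
  have havg : ∀ (a : Rn n) (r : ℝ), 0 < r →
      ∫ x in cube a r, ((⨍ y in cube a r, |b y|) - b x) = ∫ x in cube a r, (|b x| - b x) := by
    intro a r hr
    have hvr : volume.real (cube a r) ≠ 0 :=
      (ENNReal.toReal_pos (isCube_cube a hr).volume_ne_zero (isCube_cube a hr).volume_ne_top).ne'
    rw [integral_sub (hcQ a r _ hr) (hbQ a r hr), integral_sub (hbQ a r hr).abs (hbQ a r hr),
      setIntegral_const, setAverage_eq, smul_eq_mul, smul_eq_mul, mul_inv_cancel_left₀ hvr]
  set K : ℝ := 2 * E * 2 ^ β * 2 ^ n / v with hK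
  have hK0 : 0 ≤ K := by positivity
  have hball : ∀ (x : Rn n) {R : ℝ}, 0 < R →
      2 * (E * (2 * R) ^ β * (2 * R) ^ n) = K * R ^ β * volume.real (Metric.closedBall x R) := by
    intro x R hR
    rw [Measure.addHaar_real_closedBall _ _ hR.le, finrank_euclideanSpace_fin, ← hv, hK,
      Real.mul_rpow zero_le_two hR.le, mul_pow]
    field_simp
  have hmono : ∀ (x : Rn n) {R : ℝ} {F : Rn n → ℝ}, 0 < R → (∀ y, 0 ≤ F y) →
      IntegrableOn F (cube (WithLp.toLp 2 fun i => x i - R) (2 * R)) →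
      ∫ y in Metric.closedBall x R, F y ≤
        ∫ y in cube (WithLp.toLp 2 fun i => x i - R) (2 * R), F y := by
    intro x R F hR hF hFi
    exact setIntegral_mono_set hFi (Filter.Eventually.of_forall hF)
      (closedBall_subset_cube x R).eventuallyLE
  obtain ⟨L, hL, A, hA, hAL⟩ := exists_ae_holder_of_oscillation hβ₀ hK0 hb fun x R hR => by
    have h2R : 0 < 2 * R := by positivity
    set a : Rn n := WithLp.toLp 2 fun i => x i - R
    set c : ℝ := ⨍ y in cube a (2 * R), |b y|
    refine ⟨c, ?_⟩
    have hi : IntegrableOn (fun y => |b y - c|) (cube a (2 * R)) :=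
      ((hbQ a _ h2R).sub (hcQ a _ c h2R)).abs
    refine (hmono x hR (fun y => abs_nonneg _) hi).trans ?_
    rw [← hball x hR]
    have e : ∀ y, |b y - c| = 2 * max (c - b y) 0 - (c - b y) := fun y => by
      rcases le_total (c - b y) 0 with h | h
      · rw [max_eq_right h, abs_of_nonneg (by linarith)]; ring
      · rw [max_eq_left h, abs_of_nonpos (by linarith)]; ring
    have hi1 : IntegrableOn (fun y => c - b y) (cube a (2 * R)) :=
      (hcQ a _ c h2R).sub (hbQ a _ h2R)
    have h1 : 0 ≤ ∫ y in cube a (2 * R), (c - b y) := by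
      rw [havg a _ h2R]
      exact integral_nonneg fun y => sub_nonneg.2 (le_abs_self _)
    simp only [e]
    rw [integral_sub (hi1.pos_part.const_mul 2) hi1, integral_const_mul]
    linarith [hposint a _ h2R]
  have hnn : ∀ᵐ x, 0 ≤ b x := by
    have hF : LocallyIntegrable (fun x => |b x| - b x) volume :=
      LocallyIntegrable.sub (fun y => (hb y).norm) hb
    filter_upwards [IsUnifLocDoublingMeasure.ae_tendsto_average volume hF 0] with x hx
    have h1 := hx (fun _ : ℝ => x) id (l := nhdsWithin 0 (Set.Ioi 0)) Filter.tendsto_id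
      (Filter.Eventually.of_forall fun r => by simp)
    have h2 : Filter.Tendsto (fun R : ℝ => K * R ^ β) (nhdsWithin 0 (Set.Ioi 0)) (nhds 0) := by
      have : Filter.Tendsto (fun R : ℝ => K * R ^ β) (nhds 0) (nhds (K * 0 ^ β)) :=
        ((Real.continuous_rpow_const hβ₀.le).tendsto 0).const_mul K
      rw [Real.zero_rpow hβ₀.ne', mul_zero] at this
      exact this.mono_left nhdsWithin_le_nhds
    have h3 : |b x| - b x ≤ 0 := by
      refine le_of_tendsto_of_tendsto h1 h2 ?_
      filter_upwards [self_mem_nhdsWithin] with R hR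
      have hR : 0 < R := hR
      have h2R : 0 < 2 * R := by positivity
      have hvR : 0 < volume.real (Metric.closedBall x R) :=
        ENNReal.toReal_pos (Metric.measure_closedBall_pos _ x hR).ne'
          Metric.isBounded_closedBall.measure_lt_top.ne
      rw [id, setAverage_eq, smul_eq_mul, inv_mul_le_iff₀ hvR, mul_comm, ← hball x hR]
      set a : Rn n := WithLp.toLp 2 fun i => x i - R
      refine (hmono x hR (fun y => sub_nonneg.2 (le_abs_self _))
        ((hbQ a _ h2R).abs.sub (hbQ a _ h2R))).trans ?_
      rw [← havg a _ h2R]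
      have h4 : ∫ y in cube a (2 * R), ((⨍ z in cube a (2 * R), |b z|) - b y) ≤
          ∫ y in cube a (2 * R), max ((⨍ z in cube a (2 * R), |b z|) - b y) 0 :=
        integral_mono ((hcQ a _ _ h2R).sub (hbQ a _ h2R))
          ((hcQ a _ _ h2R).sub (hbQ a _ h2R)).pos_part fun y => le_max_left _ _
      have h5 : 0 ≤ E * (2 * R) ^ β * (2 * R) ^ n := by positivity
      linarith [hposint a _ h2R]
    exact (abs_nonneg _).trans (sub_nonpos.1 h3)
  have hae : ∀ᵐ x, x ∈ A ∩ {x | 0 ≤ b x} := by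
    filter_upwards [hA, hnn] with x h1 h2 using ⟨h1, h2⟩
  obtain ⟨g, hg, hgL, hg0⟩ := exists_holder_extension hβ₀ hβ₁ hL (Filter.Eventually.exists hae)
    (fun x hx => hx.2) (fun x hx y hy => hAL x hx.1 y hy.1)
  exact ⟨g, hae.mono hg, hgL, hg0⟩

theorem exists_lipschitz_of_varNorm_le {β : ℝ} (hβ₀ : 0 < β) (hβ₁ : β ≤ 1)
    {b : Rn n → ℝ} (hb : LocallyIntegrable b volume) {s : Rn n → ℝ} (hs : ∀ x, 1 ≤ s x)
    {C K : ℝ≥0} (hC : HasAverageBound s C)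
    (hK : ∀ (a : Rn n) (r : ℝ), 0 < r →
      varNorm s ((cube a r).indicator fun x => ENNReal.ofReal ((⨍ y in cube a r, |b y|) - b x)) ≤
        K * ENNReal.ofReal (r ^ β) * varNorm s ((cube a r).indicator fun _ => 1)) :
    ∃ g : Rn n → ℝ, b =ᵐ[volume] g ∧ IsHomLipschitz β g ∧ ∀ x, 0 ≤ g x := by
  refine exists_lipschitz_of_setLIntegral_le hβ₀ hβ₁ hb (E := C * K) fun a r hr => ?_
  have hQ := isCube_cube a hr
  set c := ⨍ y in cube a r, |b y|
  have hf : AEMeasurable (fun x => max (c - b x) 0) volume :=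
    (hb.aestronglyMeasurable.aemeasurable.const_sub c).max aemeasurable_const
  have hfe : ∀ x, ‖max (c - b x) 0‖ₑ = ENNReal.ofReal (c - b x) := fun x => by
    rw [Real.enorm_eq_ofReal (le_max_right _ _)]
    simp
  have h1 := hC _ hQ _ hf
  simp only [hfe] at h1
  have hN0 := varNorm_indicator_one_ne_zero hQ hs
  have hNt := varNorm_indicator_one_ne_top hQ hs
  rw [← ENNReal.div_le_iff hQ.volume_ne_zero hQ.volume_ne_top,
    ← ENNReal.mul_le_mul_iff_left hN0 hNt]
  refine h1.trans ?_
  rw [ENNReal.coe_mul, mul_assoc, mul_assoc, ← mul_assoc (K : ℝ≥0∞)]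
  gcongr
  exact hK a r hr

theorem ofReal_setAverage_abs {b : Rn n → ℝ} (hb : LocallyIntegrable b volume) (a : Rn n) {r : ℝ}
    (hr : 0 < r) :
    ENNReal.ofReal (⨍ y in cube a r, |b y|) * ENNReal.ofReal (r ^ n) =
      ∫⁻ y in cube a r, ‖b y‖ₑ := by
  have hQ := isCube_cube a hr
  have hbQ : IntegrableOn b (cube a r) :=
    (hb.integrableOn_isCompact hQ.isBounded.isCompact_closure).mono_set subset_closure
  have hvol : volume.real (cube a r) = r ^ n := by
    rw [measureReal_def, volume_cube a hr.le, ENNReal.toReal_ofReal (by positivity)]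
  rw [← ofReal_integral_norm_eq_lintegral_enorm hbQ, ← ENNReal.ofReal_mul', setAverage_eq, hvol,
    smul_eq_mul, mul_comm, mul_inv_cancel_left₀ (by positivity)]
  · rfl
  · positivity

theorem ofReal_sub_le_abs_sub {w y : ℝ} {v : ℝ≥0∞} (h : ENNReal.ofReal w ≤ v) :
    ENNReal.ofReal (w - y) ≤ ((y : EReal) - (v : EReal)).abs := by
  induction v with
  | top => simp
  | coe v =>
    rw [EReal.coe_nnreal_eq_coe_real, ← EReal.coe_sub, EReal.abs_def]
    refine ENNReal.ofReal_le_ofReal ?_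
    have h1 : w ≤ v := Real.toNNReal_le_iff_le_coe.1 (ENNReal.coe_le_coe.1 h)
    rw [abs_sub_comm]
    exact (sub_le_sub_right h1 y).trans (le_abs_self _)

theorem exists_lipschitz_of_oscillationFinite (hn : n ≠ 0) {α β : ℝ} (hβ₀ : 0 < β) (hβ₁ : β ≤ 1)
    {b : Rn n → ℝ} (hb : LocallyIntegrable b volume) {s : Rn n → ℝ}
    (hs : ExpB s) (h : OscillationFinite α β b s) :
    ∃ g : Rn n → ℝ, b =ᵐ[volume] g ∧ IsHomLipschitz β g ∧ ∀ x, 0 ≤ g x := by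
  obtain ⟨C, hC⟩ := hs.hasAverageBound
  have hs1 := hs.1.2.1
  lift (⨆ (Q : Set (Rn n)) (_ : IsCube Q),
    1 / volume Q ^ (β / (n : ℝ)) *
      (varNorm s (Q.indicator fun x =>
          ((b x : EReal) -
            ((volume Q ^ (-(α / (n : ℝ))) * fracMaxOn α Q b x : ℝ≥0∞) : EReal)).abs) /
        varNorm s (Q.indicator fun _ => 1))) to ℝ≥0 using h.ne with K hK
  refine exists_lipschitz_of_varNorm_le hβ₀ hβ₁ hb hs1 hC (K := K) fun a r hr => ?_
  have hQ := isCube_cube a hr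
  have hN0 := varNorm_indicator_one_ne_zero hQ hs1
  have hNt := varNorm_indicator_one_ne_top hQ hs1
  have hβ' := ofReal_rpow_ne_zero hr β
  have h1 := le_iSup₂ (f := fun (Q : Set (Rn n)) (_ : IsCube Q) =>
    1 / volume Q ^ (β / (n : ℝ)) *
      (varNorm s (Q.indicator fun x =>
          ((b x : EReal) -
            ((volume Q ^ (-(α / (n : ℝ))) * fracMaxOn α Q b x : ℝ≥0∞) : EReal)).abs) /
        varNorm s (Q.indicator fun _ => 1))) _ hQ
  rw [← hK] at h1
  rw [volume_cube_rpow hn a hr, one_div, mul_comm, ← div_eq_mul_inv,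
    ENNReal.div_le_iff hβ' ENNReal.ofReal_ne_top, ENNReal.div_le_iff hN0 hNt] at h1
  refine le_trans (varNorm_mono (fun x => zero_le_one.trans (hs1 x))
    (Filter.Eventually.of_forall fun x => ?_)) h1
  by_cases hx : x ∈ cube a r
  · rw [Set.indicator_of_mem hx, Set.indicator_of_mem hx]
    refine ofReal_sub_le_abs_sub ?_
    have h2 := setLIntegral_cube_le_fracMaxOn hn α b hr hx subset_rfl
    have h4 : ENNReal.ofReal (r ^ n) ≠ 0 := by simpa using pow_pos hr n
    rw [← neg_div, volume_cube_rpow hn a hr, ← ENNReal.mul_le_mul_iff_left h4 ENNReal.ofReal_ne_top,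
      ofReal_setAverage_abs hb a hr]
    refine h2.trans_eq ?_
    rw [mul_comm (ENNReal.ofReal (r ^ (-α))), mul_assoc, ← ENNReal.ofReal_mul (by positivity),
      ← Real.rpow_natCast r n, ← Real.rpow_add hr]
    congr 3
    ring
  · simp [hx]

theorem fracMax_indicator_one (hn : n ≠ 0) {α : ℝ} (hα : 0 ≤ α) (hαn : α ≤ n) {a x : Rn n} {r : ℝ}
    (hr : 0 < r) (hx : x ∈ cube a r) :
    fracMax α ((cube a r).indicator fun _ => 1) x = ENNReal.ofReal (r ^ α) := by
  have hn' : (0 : ℝ) < n := Nat.cast_pos.2 hn.bot_lt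
  have hint : ∀ Q : Set (Rn n), MeasurableSet Q →
      ∫⁻ y in Q, ‖(cube a r).indicator (fun _ => (1 : ℝ)) y‖ₑ = volume (cube a r ∩ Q) := fun Q hQ => by
    simp only [enorm_indicator_eq_indicator_enorm, enorm_one]
    rw [lintegral_indicator_const (measurableSet_cube a r), one_mul,
      Measure.restrict_apply (measurableSet_cube a r)]
  refine le_antisymm ((fracMax_le_iff hn).2 fun a' r' hr' _ => ?_) ?_
  · rw [hint _ (measurableSet_cube a' r')]
    have hv0 : 0 ≤ 1 - α / n := by rw [sub_nonneg, div_le_one hn']; exact hαn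
    calc volume (cube a r ∩ cube a' r')
        = volume (cube a r ∩ cube a' r') ^ (α / n) *
          volume (cube a r ∩ cube a' r') ^ (1 - α / n) := by
          rw [← ENNReal.rpow_add_of_nonneg _ _ (by positivity) hv0, add_sub_cancel,
            ENNReal.rpow_one]
      _ ≤ volume (cube a r) ^ (α / n) * volume (cube a' r') ^ (1 - α / n) := by
          gcongr
          · exact Set.inter_subset_left
          · exact Set.inter_subset_right
      _ = _ := by rw [volume_cube_rpow hn a hr, volume_cube_rpow_one_sub hn a' hr']
  · have h := setLIntegral_cube_le_fracMax hn α ((cube a r).indicator fun _ => 1) hr hx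
    rw [hint _ (measurableSet_cube a r), Set.inter_self, volume_cube a hr.le] at h
    rw [← ENNReal.mul_le_mul_iff_left (ofReal_rpow_ne_zero hr (n - α)) ENNReal.ofReal_ne_top]
    refine le_of_eq_of_le ?_ h
    rw [← ENNReal.ofReal_mul (by positivity), ← Real.rpow_add hr]
    simp

theorem ofReal_setAverage_sub_le_commutator (hn : n ≠ 0) {α : ℝ} (hα : 0 ≤ α) (hαn : α ≤ n)
    {b : Rn n → ℝ} (hb : LocallyIntegrable b volume) {a x : Rn n} {r : ℝ}
    (hr : 0 < r) (hx : x ∈ cube a r) :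
    ENNReal.ofReal (r ^ α) * ENNReal.ofReal ((⨍ y in cube a r, |b y|) - b x) ≤
      (commutator α b ((cube a r).indicator fun _ => 1) x).abs := by
  have hrα : 0 ≤ r ^ α := by positivity
  rw [commutator, fracMax_indicator_one hn hα hαn hr hx, EReal.coe_ennreal_ofReal,
    max_eq_left hrα, ← EReal.coe_mul, ← ENNReal.ofReal_mul hrα, mul_sub, mul_comm (r ^ α) (b x)]
  refine ofReal_sub_le_abs_sub ?_
  have h := setLIntegral_cube_le_fracMax hn α
    (fun y => b y * (cube a r).indicator (fun _ => 1) y) hr hx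
  have h1 : ∫⁻ y in cube a r, ‖b y * (cube a r).indicator (fun _ => 1) y‖ₑ =
      ∫⁻ y in cube a r, ‖b y‖ₑ :=
    setLIntegral_congr_fun (measurableSet_cube a r) fun y hy => by
      simp only [Set.indicator_of_mem hy, mul_one]
  rw [h1, ← ofReal_setAverage_abs hb a hr] at h
  rw [← ENNReal.mul_le_mul_iff_left (ofReal_rpow_ne_zero hr (n - α)) ENNReal.ofReal_ne_top]
  refine le_of_eq_of_le ?_ h
  rw [mul_comm (r ^ α), ENNReal.ofReal_mul' hrα, mul_assoc,
    ← ENNReal.ofReal_mul hrα, ← Real.rpow_add hr]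
  simp

theorem exists_lipschitz_of_commutatorBounded (hn : n ≠ 0) {α β : ℝ} (hβ₀ : 0 < β) (hβ₁ : β ≤ 1)
    (hα : 0 < α) (hαβ : α + β < n) {b : Rn n → ℝ} (hb : LocallyIntegrable b volume)
    {p q : Rn n → ℝ} (h : ExpPair (α + β) p q) (hbd : CommutatorBounded α b p q) :
    ∃ g : Rn n → ℝ, b =ᵐ[volume] g ∧ IsHomLipschitz β g ∧ ∀ x, 0 ≤ g x := by
  have hn' : (0 : ℝ) < n := Nat.cast_pos.2 hn.bot_lt
  have hγ : 0 < (n : ℝ) - (α + β) := sub_pos.2 hαβ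
  obtain ⟨C₀, hC₀⟩ := h.2.2.2.hasAverageBound
  have hs1 : ∀ x, 1 ≤ q x * ((n : ℝ) - (α + β)) / n := h.2.2.2.1.2.1
  have hr1 : 1 ≤ n / ((n : ℝ) - (α + β)) := by
    rw [le_div_iff₀ hγ]; linarith
  obtain ⟨C₁, hC₁⟩ := hC₀.mul (fun x => zero_lt_one.trans_le (hs1 x)) hr1
  have e : (fun x => n / ((n : ℝ) - (α + β)) * (q x * ((n : ℝ) - (α + β)) / n)) = q := by
    funext x
    field_simp
  rw [e] at hC₁
  have hq1 : ∀ x, 1 ≤ q x := fun x => by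
    have := one_le_mul_of_one_le_of_one_le hr1 (hs1 x)
    rwa [congrFun e x] at this
  have hp1 := h.one_le_left
  obtain ⟨C, hC⟩ := hbd
  refine exists_lipschitz_of_varNorm_le hβ₀ hβ₁ hb hq1 hC₁ (K := C * 2) fun a r hr => ?_
  have hQ := isCube_cube a hr
  set f : Rn n → ℝ := (cube a r).indicator fun _ => 1 with hf
  have hfe : (fun x => ‖f x‖ₑ) = (cube a r).indicator fun _ => 1 := by
    rw [hf, enorm_indicator_eq]
    simp
  have hmem : MemVarLp p f := by
    refine memVarLp_of_varNorm_ne_top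
      (measurable_const.indicator (measurableSet_cube a r)).aemeasurable ?_
    rw [hfe]
    exact varNorm_indicator_one_ne_top hQ hp1
  have h1 := hC f hmem
  rw [hfe] at h1
  set V : ℝ≥0 := (r ^ α).toNNReal
  have hV : (V : ℝ≥0∞) = ENNReal.ofReal (r ^ α) := rfl
  have hV0 : V ≠ 0 := (Real.toNNReal_pos.2 (Real.rpow_pos_of_pos hr α)).ne'
  rw [← ENNReal.mul_le_mul_iff_right (ENNReal.coe_ne_zero.2 hV0) ENNReal.coe_ne_top]
  calc (V : ℝ≥0∞) * varNorm q
        ((cube a r).indicator fun x => ENNReal.ofReal ((⨍ y in cube a r, |b y|) - b x))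
      ≤ varNorm q (fun x => V * (cube a r).indicator
          (fun x => ENNReal.ofReal ((⨍ y in cube a r, |b y|) - b x)) x) := mul_varNorm_le hV0
    _ ≤ varNorm q (fun x => (commutator α b f x).abs) := by
        refine varNorm_mono (fun x => zero_le_one.trans (hq1 x))
          (Filter.Eventually.of_forall fun x => ?_)
        by_cases hx : x ∈ cube a r
        · rw [Set.indicator_of_mem hx, hV]
          exact ofReal_setAverage_sub_le_commutator hn hα.le (by linarith) hb hr hx
        · simp [hx]
    _ ≤ C * varNorm p ((cube a r).indicator fun _ => 1) := h1
    _ ≤ C * (2 * ENNReal.ofReal (r ^ (α + β)) * varNorm q ((cube a r).indicator fun _ => 1)) := by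
        gcongr
        exact h.varNorm_indicator_le hn (add_pos hα hβ₀) hαβ a hr
    _ = _ := by
        rw [Real.rpow_add hr, ENNReal.ofReal_mul (by positivity), hV, ENNReal.coe_mul,
          ENNReal.coe_ofNat]
        ring

theorem exists_expPair (hn : n ≠ 0) {γ : ℝ} (hγ₀ : 0 < γ) (hγn : γ < n) :
    ∃ p q : Rn n → ℝ, ExpPair γ p q := by
  have hn' : (0 : ℝ) < n := Nat.cast_pos.2 hn.bot_lt
  have h1 : 0 < (n : ℝ) + γ := by positivity
  have h2 : 0 < (n : ℝ) - γ := sub_pos.2 hγn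
  refine ⟨fun _ => 2 * n / (n + γ), fun _ => 2 * n / (n - γ), expP_const ?_, ?_, fun _ => ?_, ?_⟩
  · rw [lt_div_iff₀ h1]; linarith
  · rw [essSup_const _ (NeZero.ne _)]
    refine EReal.coe_lt_coe_iff.2 ?_
    rw [div_lt_div_iff₀ h1 hγ₀]
    nlinarith
  · field_simp
    ring
  · have e : (fun _ : Rn n => 2 * (n : ℝ) / (n - γ) * (n - γ) / n) = fun _ => 2 := by
      funext _
      field_simp
    rw [e]
    exact expB_two hn

end Regularity

end VarLip

end

theorem theorem1p1 (n : ℕ) (α β : ℝ) (hβ₀ : 0 < β) (hβ₁ : β < 1) (hα₀ : 0 < α)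
    (hαn : α < (n : ℝ)) (hαβ : α + β < (n : ℝ))
    (b : VarLip.Rn n → ℝ) (hb : MeasureTheory.LocallyIntegrable b MeasureTheory.volume) :
    List.TFAE [
      ∃ g : VarLip.Rn n → ℝ, b =ᵐ[MeasureTheory.volume] g ∧
        VarLip.IsHomLipschitz β g ∧ ∀ x, 0 ≤ g x,
      ∃ p q : VarLip.Rn n → ℝ,
        VarLip.ExpPair (α + β) p q ∧ VarLip.CommutatorBounded α b p q,
      ∀ p q : VarLip.Rn n → ℝ,
        VarLip.ExpPair (α + β) p q → VarLip.CommutatorBounded α b p q,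
      ∃ s : VarLip.Rn n → ℝ, VarLip.ExpB s ∧ VarLip.OscillationFinite α β b s,
      ∀ s : VarLip.Rn n → ℝ, VarLip.ExpB s → VarLip.OscillationFinite α β b s] := by
  have hn : n ≠ 0 := fun h => by
    rw [h, Nat.cast_zero] at hαn
    exact hαn.not_gt hα₀
  tfae_have 1 → 3 := fun ⟨g, hbg, hg, hg0⟩ p q h =>
    VarLip.commutatorBounded_of_lipschitz hn hβ₀ hα₀ hαβ hbg hg hg0 h
  tfae_have 3 → 2 := fun h => by
    obtain ⟨p, q, hpq⟩ := VarLip.exists_expPair hn (add_pos hα₀ hβ₀) hαβ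
    exact ⟨p, q, hpq, h p q hpq⟩
  tfae_have 2 → 1 := fun ⟨p, q, hpq, h⟩ =>
    VarLip.exists_lipschitz_of_commutatorBounded hn hβ₀ hβ₁.le hα₀ hαβ hb hpq h
  tfae_have 1 → 5 := fun ⟨g, hbg, hg, hg0⟩ s hs =>
    VarLip.oscillationFinite_of_lipschitz hn hβ₀.le hα₀.le hbg hg hg0 hs.1.2.1
  tfae_have 5 → 4 := fun h => ⟨fun _ => 2, VarLip.expB_two hn, h _ (VarLip.expB_two hn)⟩
  tfae_have 4 → 1 := fun ⟨s, hs, h⟩ =>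
    VarLip.exists_lipschitz_of_oscillationFinite hn hβ₀ hβ₁.le hb hs h
  tfae_finish
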